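/- Let $(X,d,\mu)$ be a complete metric measure space ($\mu$ a Borel measure), $(Y,d)$ a complete metric space, $\Omega\subset X$ a bounded domain (non-empty, open, connected), and $\mathcal H$ a $\sigma$-finite Borel regular measure on $\partial\Omega$. Write $⨍$ for mean values. **Sobolev maps.** Let $1<p<\infty$ and let $Z$ be a metric space. $L^p(\Omega,Z)$ consists of the measurable, essentially separably valued maps $u:\Omega\to Z$ with $d(u,z_0)\in L^p(\Omega)$ for some $z_0\in Z$; $u_i\to u$ in $L^p(\Omega,Z)$ means $\int_\Omega d(u_i,u)^p\,d\mu\to0$; similarly for $L^p(\partial\Omega,Z)$ with the measure $\mathcal H$. A Borel function $g:\Omega\to[0,\infty]$ is an upper gradient of $u:\Omega\to Z$ if $d(u(\gamma(a)),u(\gamma(b)))\le\int_\gamma g\,ds$ for every rectifiable curve $\gamma:[a,b]\to\Omega$, and a $p$-weak upper gradient if this holds for all rectifiable curves outside a family of $p$-modulus zero. $N^{1,p}(\Omega,Z)$ is the set of all $u\in L^p(\Omega,Z)$ with a $p$-weak upper gradient in $L^p(\Omega)$, and $E^p(u)=\inf_g\int_\Omega g^p\,d\mu$ over all $p$-weak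 upper gradients $g$ of $u$, that is, $E^p(u)=\int_\Omega g_u^p\,d\mu$ for the minimal $p$-weak upper gradient $g_u$. **Traces.** A map $Tu:\partial\Omega\to Z$ is a trace of a measurable map $u:\Omega\to Z$ if for $\mathcal H$-a.e. $x\in\partial\Omega$ $$\lim_{r\to0^+}⨍_{B(x,r)\cap\Omega}d(u,Tu(x))\,d\mu=0 .$$ **Admissibility.** Let $\theta>0$. $\Omega$ is weakly $(p,\theta)$-admissible if $1<p<\infty$, $\theta<p$, and there are constants $C<\infty$ and $\lambda\ge1$ such that 1. $0<\mu(B(x,2r)\cap\Omega)\le C\mu(B(x,r)\cap\Omega)<\infty$ for all $x\in\overline\Omega$, $r>0$; 2. $\mathcal H(B(x,r)\cap\partial\Omega)\le C\,r^{-\theta}\mu(B(x,r)\cap\Omega)$ for all $x\in\partial\Omega$, $0<r\le\operatorname{diam}\Omega$; 3. for all $x\in\Omega$, $r>0$, all $u\in L^1_{\rm loc}(\Omega)$ that are integrable on $B(x,r)\cap\Omega$, and all upper gradients $g$ of $u$, $$⨍_{B(x,r)\cap\Omega}|u-u_{B(x,r)\cap\Omega}|\,d\mu\le C r\Big(⨍_{B(x,\lambda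 r)\cap\Omega}g^p\,d\mu\Big)^{1/p}.$$ ($\Omega$ is $(p,\theta)$-admissible if, in addition, it supports a global Poincaré inequality for Sobolev functions with zero trace; this is not needed below.) **Theorem.** Let $\Omega$ be weakly $(p,\theta)$-admissible (in particular, this holds if $\Omega$ is $(p,\theta)$-admissible). Then every $u\in N^{1,p}(\Omega,Y)$ has a trace $Tu$, and $Tu\in L^p(\partial\Omega,Y)$. Moreover: (a) If $u_i\in N^{1,p}(\Omega,Y)$, $i\in\mathbb N$, satisfy $\sup_iE^p(u_i)<\infty$ and $u_i\to u$ in $L^p(\Omega,Y)$ for some $u\in N^{1,p}(\Omega,Y)$, then $Tu_i\to Tu$ in $L^p(\partial\Omega,Y)$. (b) For $u,v\in N^{1,p}(\Omega,Y)$, one has $Tu=Tv$ $\mathcal H$-a.e. on $\partial\Omega$ if and only if $d(u,v)\in N^{1,p}(\Omega,\mathbb R)$ and $d(u,v)$ has trace zero, i.e. the function $0$ is a trace of $d(u,v)$. -/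

import Mathlib

open MeasureTheory Filter Topology Set
open scoped ENNReal NNReal

noncomputable section

namespace MetricTrace

/-- A rectifiable curve `γ : [a, b] → Ω`: continuous on `[a, b]`, with values in `Ω` and of finite
length. The values of `toFun` outside `[a, b]` play no role. -/
structure RectifiableCurve {X : Type*} [MetricSpace X] (Ω : Set X) where
  /-- left end of the parameter interval -/
  a : ℝ
  /-- right end of the parameter interval -/
  b : ℝ
  /-- the parametrization -/
  toFun : ℝ → X
  a_le_b : a ≤ b
  continuousOn : ContinuousOn toFun (Icc a b)
  mapsTo : MapsTo toFun (Icc a b) Ω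
  rectifiable : eVariationOn toFun (Icc a b) ≠ ∞

/-- The length of a rectifiable curve. -/
def RectifiableCurve.length {X : Type*} [MetricSpace X] {Ω : Set X}
    (γ : RectifiableCurve Ω) : ℝ :=
  (eVariationOn γ.toFun (Icc γ.a γ.b)).toReal

/-- The line integral `∫_γ g ds = ∫_0^ℓ g (γ_s t) dt`, where `γ_s : [0, ℓ] → Ω` is the
parametrization of `γ` by arc length. -/
def RectifiableCurve.lineIntegral {X : Type*} [MetricSpace X] {Ω : Set X}
    (γ : RectifiableCurve Ω) (g : X → ℝ≥0∞) : ℝ≥0∞ :=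
  ∫⁻ t in Icc (0 : ℝ) γ.length, g (naturalParameterization γ.toFun (Icc γ.a γ.b) γ.a t)

/-- The `p`-modulus of a family of rectifiable curves in `Ω`. -/
def modulus {X : Type*} [MetricSpace X] [MeasurableSpace X] (μ : Measure X) {Ω : Set X} (p : ℝ)
    (Γ : Set (RectifiableCurve Ω)) : ℝ≥0∞ :=
  ⨅ (ρ : X → ℝ≥0∞) (_ : Measurable ρ) (_ : ∀ γ ∈ Γ, 1 ≤ γ.lineIntegral ρ),
    ∫⁻ x in Ω, ρ x ^ p ∂μ

/-- `g` is an upper gradient of `u` in `Ω`. (Functions on the open set `Ω` are given as functions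
on `X` of which only the values on `Ω` matter.) -/
def IsUpperGradient {X Z : Type*} [MetricSpace X] [MeasurableSpace X] [MetricSpace Z]
    (Ω : Set X) (u : X → Z) (g : X → ℝ≥0∞) : Prop :=
  Measurable g ∧
    ∀ γ : RectifiableCurve Ω, edist (u (γ.toFun γ.b)) (u (γ.toFun γ.a)) ≤ γ.lineIntegral g

/-- `g` is a `p`-weak upper gradient of `u` in `Ω`: the upper gradient inequality holds for
`p`-almost every curve, i.e. the curves on which it fails form a family of `p`-modulus zero. -/
def IsWeakUpperGradient {X Z : Type*} [MetricSpace X] [MeasurableSpace X] [MetricSpace Z]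
    (μ : Measure X) (Ω : Set X) (p : ℝ) (u : X → Z) (g : X → ℝ≥0∞) : Prop :=
  Measurable g ∧
    modulus μ p {γ : RectifiableCurve Ω |
      ¬ edist (u (γ.toFun γ.b)) (u (γ.toFun γ.a)) ≤ γ.lineIntegral g} = 0

/-- `g` is a minimal `p`-weak upper gradient of `u` in `Ω`. -/
def IsMinimalWeakUpperGradient {X Z : Type*} [MetricSpace X] [MeasurableSpace X] [MetricSpace Z]
    (μ : Measure X) (Ω : Set X) (p : ℝ) (u : X → Z) (g : X → ℝ≥0∞) : Prop :=
  IsWeakUpperGradient μ Ω p u g ∧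
    ∀ g' : X → ℝ≥0∞, IsWeakUpperGradient μ Ω p u g' → g ≤ᵐ[μ.restrict Ω] g'

/-- The `p`-energy `E^p(u) = inf_g ∫_Ω g ^ p dμ`, the infimum over all `p`-weak upper gradients
of `u`. It is `∫_Ω g_u ^ p dμ` for the minimal one, see `energy_eq_of_isMinimal`. -/
def energy {X Z : Type*} [MetricSpace X] [MeasurableSpace X] [MetricSpace Z]
    (μ : Measure X) (Ω : Set X) (p : ℝ) (u : X → Z) : ℝ≥0∞ :=
  ⨅ (g : X → ℝ≥0∞) (_ : IsWeakUpperGradient μ Ω p u g), ∫⁻ x in Ω, g x ^ p ∂μ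

theorem energy_eq_of_isMinimal {X Z : Type*} [MetricSpace X] [MeasurableSpace X] [MetricSpace Z]
    {μ : Measure X} {Ω : Set X} {p : ℝ} (hp : 0 ≤ p) {u : X → Z} {g : X → ℝ≥0∞}
    (hg : IsMinimalWeakUpperGradient μ Ω p u g) :
    energy μ Ω p u = ∫⁻ x in Ω, g x ^ p ∂μ := by
  refine le_antisymm (iInf₂_le g hg.1) (le_iInf₂ fun g' hg' => lintegral_mono_ae ?_)
  filter_upwards [hg.2 g' hg'] with x hx
  exact ENNReal.rpow_le_rpow hx hp

/-- `u ∈ L^p(ν, Z)` for a metric space `Z`: `u` is measurable and essentially separably valued,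
and `d(u, z₀) ∈ L^p(ν)` for some `z₀`. -/
def MemLpMetric {S Z : Type*} [MeasurableSpace S] [MetricSpace Z] (ν : Measure S) (p : ℝ)
    (u : S → Z) : Prop :=
  AEStronglyMeasurable u ν ∧ ∃ z₀ : Z, ∫⁻ x, edist (u x) z₀ ^ p ∂ν < ∞

/-- Convergence `u_i → u` in `L^p(ν, Z)`. -/
def TendstoLpMetric {S Z : Type*} [MeasurableSpace S] [MetricSpace Z] (ν : Measure S) (p : ℝ)
    (u : ℕ → S → Z) (v : S → Z) : Prop :=
  Tendsto (fun i => ∫⁻ x, edist (u i x) (v x) ^ p ∂ν) atTop (𝓝 0)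

/-- `u ∈ N^{1,p}(Ω, Z)`: `u ∈ L^p(Ω, Z)` has a `p`-weak upper gradient in `L^p(Ω)`. -/
def MemSobolev {X Z : Type*} [MetricSpace X] [MeasurableSpace X] [MetricSpace Z]
    (μ : Measure X) (Ω : Set X) (p : ℝ) (u : X → Z) : Prop :=
  MemLpMetric (μ.restrict Ω) p u ∧
    ∃ g : X → ℝ≥0∞, IsWeakUpperGradient μ Ω p u g ∧ ∫⁻ x in Ω, g x ^ p ∂μ < ∞

/-- `y` is the trace of `u` at the point `x`. -/
def IsTraceAt {X Z : Type*} [MetricSpace X] [MeasurableSpace X] [MetricSpace Z]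
    (μ : Measure X) (Ω : Set X) (u : X → Z) (x : X) (y : Z) : Prop :=
  Tendsto (fun r : ℝ => ⨍⁻ z in Metric.ball x r ∩ Ω, edist (u z) y ∂μ) (𝓝[>] 0) (𝓝 0)

/-- `f : ∂Ω → Z` is the trace `Tu` of `u`: `f x` is the trace of `u` at `x` for `H`-almost every
`x ∈ ∂Ω`. -/
def IsTrace {X Z : Type*} [MetricSpace X] [MeasurableSpace X] [MetricSpace Z]
    (μ : Measure X) (Ω : Set X) (H : Measure (frontier Ω)) (u : X → Z)
    (f : frontier Ω → Z) : Prop :=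
  ∀ᵐ x : frontier Ω ∂H, IsTraceAt μ Ω u (x : X) (f x)

/-- `μ` is a doubling measure on `Ω`. -/
def IsDoublingOn {X : Type*} [MetricSpace X] [MeasurableSpace X] (μ : Measure X)
    (Ω : Set X) : Prop :=
  ∃ C : ℝ≥0, ∀ x ∈ closure Ω, ∀ r : ℝ, 0 < r →
    0 < μ (Metric.ball x (2 * r) ∩ Ω) ∧
    μ (Metric.ball x (2 * r) ∩ Ω) ≤ C * μ (Metric.ball x r ∩ Ω) ∧
    μ (Metric.ball x r ∩ Ω) < ∞

/-- `H` is upper codimension-`θ` regular on `∂Ω`. The radii are bounded by `diam Ω`: an estimate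
for arbitrarily large radii would force `H = 0`. A ball of the subspace `∂Ω` is `B(x, r) ∩ ∂Ω`. -/
def IsUpperCodimRegular {X : Type*} [MetricSpace X] [MeasurableSpace X] (μ : Measure X)
    (Ω : Set X) (H : Measure (frontier Ω)) (θ : ℝ) : Prop :=
  ∃ C : ℝ≥0, ∀ x : frontier Ω, ∀ r : ℝ, 0 < r → r ≤ Metric.diam Ω →
    H (Metric.ball x r) ≤ C * (μ (Metric.ball (x : X) r ∩ Ω) / ENNReal.ofReal (r ^ θ))

/-- `Ω` supports a local `q`-Poincaré inequality. The inequality is only asked for when the mean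
value of `u` over `B(x, r) ∩ Ω` is meaningful, i.e. when `u` is integrable there. -/
def SupportsLocalPoincare {X : Type*} [MetricSpace X] [MeasurableSpace X] (μ : Measure X)
    (Ω : Set X) (q : ℝ) : Prop :=
  ∃ (C : ℝ≥0) (lam : ℝ), 1 ≤ lam ∧ ∀ x ∈ Ω, ∀ r : ℝ, 0 < r →
    ∀ (u : X → ℝ) (g : X → ℝ≥0∞), LocallyIntegrableOn u Ω μ →
      IntegrableOn u (Metric.ball x r ∩ Ω) μ → IsUpperGradient Ω u g →
      ⨍⁻ y in Metric.ball x r ∩ Ω, edist (u y) (⨍ z in Metric.ball x r ∩ Ω, u z ∂μ) ∂μ ≤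
        C * ENNReal.ofReal r * (⨍⁻ y in Metric.ball x (lam * r) ∩ Ω, g y ^ q ∂μ) ^ (1 / q)

/-- `Ω` (with the measure `μ`, and `H` on `∂Ω`) is weakly `(q, θ)`-admissible. -/
structure IsWeaklyAdmissible {X : Type*} [MetricSpace X] [MeasurableSpace X] (μ : Measure X)
    (Ω : Set X) (H : Measure (frontier Ω)) (q θ : ℝ) : Prop where
  one_lt : 1 < q
  theta_pos : 0 < θ
  theta_lt : θ < q
  doubling : IsDoublingOn μ Ω
  codim : IsUpperCodimRegular μ Ω H θ
  poincare : SupportsLocalPoincare μ Ω q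

end MetricTrace

end

/-!
The trace of a Sobolev map `u` at a boundary point is the limit of almost mean values of `u` over
the dyadic balls `B(x, r / 2 ^ j) ∩ Ω`, and it exists wherever the oscillations of `u` on these
balls are summable. Two facts give the summability at `H`-almost every `x`.

* **A pointwise estimate in the domain.** The Poincaré inequality is assumed for real functions
  only. For `f = d(u, y)`, which has the same upper gradients as `u`, telescoping over dyadic balls
  around a Lebesgue point `z` bounds the deviation of `f z` from its mean over `B(z, r) ∩ Ω` by the
  `potential` `∑ i, r_i (⨍_{B(z, λ r_i) ∩ Ω} g ^ p) ^ (1 / p)`, `r_i = r / 2 ^ i`, of an upper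
  gradient `g`. This does not depend on `y`; letting `y` run through a countable dense subset of the
  essential range gives `d(u z, u w) ≤ K (potential (4 * r) z + potential (4 * r) w)` for almost all
  `z`, `w` with `d(z, w) < 2 * r` (`IsDoublingWith.exists_forall_edist_le_potential`). So the
  oscillation of `u` on `B(x, r) ∩ Ω` is at most a multiple of the average of the potential, and the
  sum of these averages over dyadic radii, the `boundaryPotential`, controls the mean distance of
  `u` from its trace at `x`.
* **Fubini's theorem.** If a measure `ν` satisfies `ν(B(x, 2R)) ≤ K μ(B(x, 2R) ∩ Ω)`, then
  integrating `x ↦ ⨍_{B(x, R) ∩ Ω} h` against `ν` gives at most a multiple of `K ∫_Ω h`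
  (`IsDoublingWith.lintegral_laverage_le`). With `ν = μ` this bounds the `L^p` norm of the potential
  at scale `r` by `r ‖g‖_p`; with `ν = H`, where `K` is of the order `R ^ (-θ)`, it bounds the
  `L^p(H)` norm of the average of the potential over `B(x, r) ∩ Ω` by `r ^ (1 - θ / p) ‖g‖_p`. Since
  `θ < p`, these bounds are summable over dyadic radii
  (`IsWeaklyAdmissibleWith.exists_lintegral_boundaryPotential_le`).

Hence the boundary potential at scale `r` has `L^p(H)` norm `O(r ^ (1 - θ / p))`, uniformly on
energy bounded sets. This yields existence and integrability of the trace. For the convergence of traces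
compare `Tu_i` and `Tv` through the averages of `d(u_i, v)` over `B(x, r) ∩ Ω`: the two boundary
potentials are small with `r`, uniformly in `i`, and for fixed `r` the remaining term is controlled
by the `L^p` distance of `u_i` and `v`. The characterization of equal traces is the triangle
inequality under mean values. Weak upper gradients are first replaced by upper gradients of
comparable energy (`IsWeakUpperGradient.exists_isUpperGradient`).
-/

noncomputable section

namespace MetricTrace

/-! ### Doubling measures on a domain -/

/-- The doubling condition on `Ω` with an explicit constant. -/
def IsDoublingWith {X : Type*} [MetricSpace X] [MeasurableSpace X] (μ : Measure X) (Ω : Set X)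
    (C : ℝ≥0) : Prop :=
  ∀ x ∈ closure Ω, ∀ r : ℝ, 0 < r →
    0 < μ (Metric.ball x (2 * r) ∩ Ω) ∧
    μ (Metric.ball x (2 * r) ∩ Ω) ≤ C * μ (Metric.ball x r ∩ Ω) ∧
    μ (Metric.ball x r ∩ Ω) < ∞

section Doubling

variable {X : Type*} [MetricSpace X] [MeasurableSpace X] {μ : Measure X} {Ω : Set X} {C : ℝ≥0}

theorem IsDoublingWith.pos (hD : IsDoublingWith μ Ω C) {x : X} (hx : x ∈ closure Ω) {r : ℝ}
    (hr : 0 < r) : 0 < μ (Metric.ball x r ∩ Ω) := by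
  have := (hD x hx (r / 2) (by positivity)).1
  rwa [mul_div_cancel₀ r two_ne_zero] at this

theorem IsDoublingWith.lt_top (hD : IsDoublingWith μ Ω C) {x : X} (hx : x ∈ closure Ω) (r : ℝ) :
    μ (Metric.ball x r ∩ Ω) < ∞ := by
  rcases le_or_gt r 0 with hr | hr
  · simp [Metric.ball_eq_empty.2 hr]
  · exact (hD x hx r hr).2.2

theorem IsDoublingWith.four_mul (hD : IsDoublingWith μ Ω C) {x : X} (hx : x ∈ closure Ω) {r : ℝ}
    (hr : 0 < r) : μ (Metric.ball x (4 * r) ∩ Ω) ≤ (C : ℝ≥0∞) ^ 2 * μ (Metric.ball x r ∩ Ω) := by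
  have h1 := (hD x hx (2 * r) (by positivity)).2.1
  have h2 := (hD x hx r hr).2.1
  rw [← mul_assoc, show (2 : ℝ) * 2 = 4 by norm_num] at h1
  calc _ ≤ (C : ℝ≥0∞) * μ (Metric.ball x (2 * r) ∩ Ω) := h1
    _ ≤ C * (C * μ (Metric.ball x r ∩ Ω)) := by gcongr
    _ = _ := by ring

theorem IsDoublingWith.measure_lt_top (hD : IsDoublingWith μ Ω C)
    (hb : Bornology.IsBounded Ω) : μ Ω < ∞ := by
  rcases Ω.eq_empty_or_nonempty with rfl | ⟨x, hx⟩
  · simp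
  · obtain ⟨R, hR⟩ := hb.subset_ball x
    rw [← inter_eq_right.2 hR]
    exact hD.lt_top (subset_closure hx) R

/-- Averages over comparable balls are comparable. -/
theorem IsDoublingWith.laverage_le (hD : IsDoublingWith μ Ω C) {x y : X} (hx : x ∈ closure Ω)
    {s t : ℝ} (hs : 0 < s)
    (hst : Metric.ball x s ∩ Ω ⊆ Metric.ball y t)
    (hts : Metric.ball y t ∩ Ω ⊆ Metric.ball x (4 * s)) (h : X → ℝ≥0∞) :
    ⨍⁻ z in Metric.ball x s ∩ Ω, h z ∂μ ≤
      (C : ℝ≥0∞) ^ 2 * ⨍⁻ z in Metric.ball y t ∩ Ω, h z ∂μ := by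
  rw [setLAverage_eq, setLAverage_eq]
  have h1 : μ (Metric.ball y t ∩ Ω) ≤ (C : ℝ≥0∞) ^ 2 * μ (Metric.ball x s ∩ Ω) :=
    (measure_mono (subset_inter hts inter_subset_right)).trans (hD.four_mul hx hs)
  have hp := hD.pos hx hs
  have ht := hD.lt_top hx s
  have hp' : 0 < μ (Metric.ball y t ∩ Ω) :=
    hp.trans_le (measure_mono fun z hz => ⟨hst hz, hz.2⟩)
  have ht' : μ (Metric.ball y t ∩ Ω) < ∞ :=
    h1.trans_lt (ENNReal.mul_lt_top (by finiteness) ht)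
  rw [ENNReal.div_le_iff hp.ne' ht.ne]
  calc ∫⁻ z in Metric.ball x s ∩ Ω, h z ∂μ ≤ ∫⁻ z in Metric.ball y t ∩ Ω, h z ∂μ :=
        lintegral_mono_set fun z hz => ⟨hst hz, hz.2⟩
    _ = (∫⁻ z in Metric.ball y t ∩ Ω, h z ∂μ) / μ (Metric.ball y t ∩ Ω) *
          μ (Metric.ball y t ∩ Ω) := (ENNReal.div_mul_cancel hp'.ne' ht'.ne).symm
    _ ≤ (∫⁻ z in Metric.ball y t ∩ Ω, h z ∂μ) / μ (Metric.ball y t ∩ Ω) *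
          ((C : ℝ≥0∞) ^ 2 * μ (Metric.ball x s ∩ Ω)) := by gcongr
    _ = _ := by ring

/-- A doubling measure charges every ball, so a separated subset of `Ω` is countable and `Ω` is
separable. -/
theorem IsDoublingWith.secondCountableTopology [OpensMeasurableSpace X]
    (hD : IsDoublingWith μ Ω C) (hΩ : MeasurableSet Ω) (hb : Bornology.IsBounded Ω) :
    SecondCountableTopology Ω := by
  refine Metric.secondCountable_of_almost_dense_set fun ε hε => ?_
  obtain ⟨s, hs⟩ := zorn_subset {s : Set Ω | ∀ x ∈ s, ∀ y ∈ s, x ≠ y → ε ≤ dist x y} (by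
    intro c hc hchain
    refine ⟨⋃₀ c, ?_, fun s hs => subset_sUnion_of_mem hs⟩
    rintro x ⟨s, hs, hxs⟩ y ⟨t, ht, hyt⟩ hxy
    rcases hchain.total hs ht with h | h
    · exact hc ht x (h hxs) y hyt hxy
    · exact hc hs x hxs y (h hyt) hxy)
  refine ⟨s, ?_, fun x => ?_⟩
  · let A : s → Set X := fun x => Metric.ball (x : Ω).1 (ε / 2) ∩ Ω
    have hA : ∀ i, 0 < μ (A i) := fun i => hD.pos (subset_closure i.1.2) (by positivity)
    have hc := Measure.countable_meas_pos_of_disjoint_of_meas_iUnion_ne_top μ (As := A)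
      (fun i => Metric.isOpen_ball.measurableSet.inter hΩ) (by
        intro i j hij
        refine Disjoint.mono inter_subset_left inter_subset_left (Metric.ball_disjoint_ball ?_)
        have := hs.prop i.1 i.2 j.1 j.2 (fun h => hij (Subtype.ext h))
        rw [Subtype.dist_eq] at this
        linarith)
      ((measure_mono (iUnion_subset fun i => inter_subset_right)).trans_lt
        (hD.measure_lt_top hb)).ne
    simp only [hA, ofPred_true] at hc
    exact countable_coe_iff.1 (countable_univ_iff.1 hc)
  · by_contra! hcon
    have hins : insert x s ∈ {s : Set Ω | ∀ x ∈ s, ∀ y ∈ s, x ≠ y → ε ≤ dist x y} := by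
      intro a ha b hb' hab
      rcases ha with rfl | ha <;> rcases hb' with rfl | hb'
      · exact absurd rfl hab
      · exact (hcon b hb').le
      · rw [dist_comm]; exact (hcon a ha).le
      · exact hs.prop a ha b hb' hab
    have hxs : x ∈ s := hs.le_of_ge hins (subset_insert x s) (mem_insert x s)
    have := hcon x hxs
    rw [dist_self] at this
    linarith

end Doubling

/-! ### Averages over balls with variable centre -/

section Averages

variable {X : Type*} [MetricSpace X] [MeasurableSpace X] [BorelSpace X] {μ : Measure X} {Ω : Set X}
  {C : ℝ≥0}

/-- On `X × Ω` the set `{dist x z < R}` coincides with a set measurable for the product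
`σ`-algebra, even though `X` itself need not be separable. -/
theorem exists_measurableSet_dist_lt (hsep : SecondCountableTopology Ω) (R : ℝ) :
    ∃ E : Set (X × X), MeasurableSet E ∧
      ∀ x : X, ∀ z ∈ Ω, (x, z) ∈ E ↔ dist x z < R := by
  obtain ⟨D, hDc, hDd⟩ := TopologicalSpace.exists_countable_dense Ω
  refine ⟨⋃ q ∈ D, ⋃ s : ℚ, Metric.ball (q : X) (R - s) ×ˢ Metric.ball (q : X) s, ?_, ?_⟩
  · exact MeasurableSet.biUnion hDc fun q _ => MeasurableSet.iUnion fun s =>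
      Metric.isOpen_ball.measurableSet.prod Metric.isOpen_ball.measurableSet
  · intro x z hz
    simp only [mem_iUnion, mem_prod, Metric.mem_ball]
    constructor
    · rintro ⟨q, -, s, h1, h2⟩
      have := dist_triangle_right x z (q : X)
      linarith
    · intro h
      obtain ⟨q, hqD, hq⟩ := hDd.exists_dist_lt ⟨z, hz⟩ (ε := (R - dist x z) / 2) (by linarith)
      obtain ⟨s, hs1, hs2⟩ := exists_rat_btwn hq
      rw [Subtype.dist_eq] at hs1
      have h3 := dist_triangle x z (q : X)
      exact ⟨q, hqD, s, by simp only at *; linarith, hs1⟩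

theorem measurable_setLIntegral_ball [SFinite (μ.restrict Ω)] (hΩ : MeasurableSet Ω)
    (hsep : SecondCountableTopology Ω) (R : ℝ) {h : X → ℝ≥0∞}
    (hh : AEMeasurable h (μ.restrict Ω)) :
    Measurable fun x => ∫⁻ z in Metric.ball x R ∩ Ω, h z ∂μ := by
  obtain ⟨E, hE, hEiff⟩ := exists_measurableSet_dist_lt hsep R
  have key : (fun x => ∫⁻ z in Metric.ball x R ∩ Ω, h z ∂μ) =
      fun x => ∫⁻ z in Ω, E.indicator (fun q : X × X => hh.mk h q.2) (x, z) ∂μ := by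
    funext x
    rw [← Measure.restrict_restrict Metric.isOpen_ball.measurableSet,
      ← lintegral_indicator Metric.isOpen_ball.measurableSet]
    refine lintegral_congr_ae ?_
    filter_upwards [hh.ae_eq_mk, ae_restrict_mem hΩ] with z hz hzΩ
    have := hEiff x z hzΩ
    by_cases hxz : dist x z < R
    · rw [indicator_of_mem (this.2 hxz), indicator_of_mem (by rwa [Metric.mem_ball']), hz]
    · rw [indicator_of_notMem (by rwa [Metric.mem_ball']),
        indicator_of_notMem (by exact fun h => hxz (this.1 h))]
  rw [key]
  exact Measurable.lintegral_prod_right' ((hh.measurable_mk.comp measurable_snd).indicator hE)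

theorem measurable_laverage_ball [SFinite (μ.restrict Ω)] (hΩ : MeasurableSet Ω)
    (hsep : SecondCountableTopology Ω) (R : ℝ) {h : X → ℝ≥0∞}
    (hh : AEMeasurable h (μ.restrict Ω)) :
    Measurable fun x => ⨍⁻ z in Metric.ball x R ∩ Ω, h z ∂μ := by
  simp_rw [setLAverage_eq]
  refine (measurable_setLIntegral_ball hΩ hsep R hh).div ?_
  simpa using measurable_setLIntegral_ball hΩ hsep R (μ := μ) (h := fun _ => 1) aemeasurable_const

/-- Integrating averages over balls of radius `R` against a measure `ν` that is dominated by `μ` on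
balls of radius `2 * R` costs only a constant. It is applied to `ν = μ` on `Ω` and to `ν = H` on
the boundary. -/
theorem IsDoublingWith.lintegral_laverage_le [SFinite (μ.restrict Ω)] (hD : IsDoublingWith μ Ω C)
    (hΩ : MeasurableSet Ω) (hsep : SecondCountableTopology Ω)
    {S : Type*} [MeasurableSpace S] (ν : Measure S) [SFinite ν] {e : S → X} (he : Measurable e)
    {R : ℝ} (hR : 0 < R) {K : ℝ≥0∞}
    (hν : ∀ᵐ s ∂ν, e s ∈ closure Ω ∧
      ν (e ⁻¹' Metric.ball (e s) (2 * R)) ≤ K * μ (Metric.ball (e s) (2 * R) ∩ Ω))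
    {h : X → ℝ≥0∞} (hh : AEMeasurable h (μ.restrict Ω)) :
    ∫⁻ s, ⨍⁻ z in Metric.ball (e s) R ∩ Ω, h z ∂μ ∂ν ≤
      (C : ℝ≥0∞) ^ 2 * K * ∫⁻ z in Ω, h z ∂μ := by
  obtain ⟨E, hE, hEiff⟩ := exists_measurableSet_dist_lt hsep R
  set w : X → ℝ≥0∞ := fun x => (μ (Metric.ball x R ∩ Ω))⁻¹ with hw
  have hwm : Measurable w := by
    refine Measurable.inv ?_
    simpa using measurable_setLIntegral_ball hΩ hsep R (μ := μ) (h := fun _ => 1)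
      aemeasurable_const
  set F : S × X → ℝ≥0∞ := fun q =>
    ((fun q : S × X => (e q.1, q.2)) ⁻¹' E).indicator (fun q => w (e q.1) * hh.mk h q.2) q with hF
  have hFm : Measurable F :=
    (((hwm.comp he).comp measurable_fst).mul (hh.measurable_mk.comp measurable_snd)).indicator
      (((he.comp measurable_fst).prodMk measurable_snd) hE)
  have key : ∀ s, ⨍⁻ z in Metric.ball (e s) R ∩ Ω, h z ∂μ = ∫⁻ z in Ω, F (s, z) ∂μ := by
    intro s
    rw [setLAverage_eq, ← Measure.restrict_restrict Metric.isOpen_ball.measurableSet,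
      ← lintegral_indicator Metric.isOpen_ball.measurableSet, ENNReal.div_eq_inv_mul,
      ← lintegral_const_mul'' _ (hh.indicator Metric.isOpen_ball.measurableSet)]
    refine lintegral_congr_ae ?_
    filter_upwards [hh.ae_eq_mk, ae_restrict_mem hΩ] with z hz hzΩ
    have := hEiff (e s) z hzΩ
    by_cases hxz : dist (e s) z < R
    · rw [indicator_of_mem (by rwa [Metric.mem_ball']), hz, hF]
      simp only
      rw [indicator_of_mem (by exact this.2 hxz)]
    · rw [indicator_of_notMem (by rwa [Metric.mem_ball']), hF]
      simp only
      rw [indicator_of_notMem (by exact fun h => hxz (this.1 h)), mul_zero]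
  simp_rw [key]
  rw [lintegral_lintegral_swap hFm.aemeasurable, ← lintegral_const_mul'' _ hh]
  refine lintegral_mono_ae ?_
  filter_upwards [hh.ae_eq_mk, ae_restrict_mem hΩ] with z hz hzΩ
  have hBm : MeasurableSet (e ⁻¹' Metric.ball z R) := he Metric.isOpen_ball.measurableSet
  have h1 : ∫⁻ s, F (s, z) ∂ν = h z * ∫⁻ s in e ⁻¹' Metric.ball z R, w (e s) ∂ν := by
    rw [← lintegral_const_mul _ (f := fun s => w (e s)) (hwm.comp he), ← lintegral_indicator hBm]
    congr 1
    funext s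
    have := hEiff (e s) z hzΩ
    by_cases hxz : dist (e s) z < R
    · rw [indicator_of_mem (by exact hxz), hz, hF]
      simp only
      rw [indicator_of_mem (by exact this.2 hxz), mul_comm]
    · rw [indicator_of_notMem (by exact hxz), hF]
      simp only
      rw [indicator_of_notMem (by exact fun h => hxz (this.1 h))]
  rw [h1, mul_comm]
  gcongr
  by_cases hnull : ν (e ⁻¹' Metric.ball z R) = 0
  · rw [Measure.restrict_eq_zero.2 hnull]; simp
  -- a good point `y` of the support near `z`: the balls around all points near `z` are compared
  -- with the ball around `y`
  obtain ⟨y, hyz, hy, hyν⟩ : ∃ y ∈ e ⁻¹' Metric.ball z R, e y ∈ closure Ω ∧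
      ν (e ⁻¹' Metric.ball (e y) (2 * R)) ≤ K * μ (Metric.ball (e y) (2 * R) ∩ Ω) := by
    by_contra! hcon
    refine hnull (measure_mono_null (fun s hs => ?_) (ae_iff.1 hν))
    simp only [mem_ofPred_eq, not_and, not_le]
    exact hcon s hs
  have hyz' : dist (e y) z < R := hyz
  have hpos := hD.pos hy (r := 2 * R) (by positivity)
  have htop := hD.lt_top hy (2 * R)
  have hwle : ∀ᵐ s ∂ν.restrict (e ⁻¹' Metric.ball z R),
      w (e s) ≤ (C : ℝ≥0∞) ^ 2 * (μ (Metric.ball (e y) (2 * R) ∩ Ω))⁻¹ := by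
    filter_upwards [ae_restrict_mem hBm, ae_restrict_of_ae hν] with s hs hsν
    have hs' : dist (e s) z < R := hs
    have h4 : μ (Metric.ball (e y) (2 * R) ∩ Ω) ≤
        (C : ℝ≥0∞) ^ 2 * μ (Metric.ball (e s) R ∩ Ω) := by
      refine (measure_mono (inter_subset_inter_left Ω (Metric.ball_subset_ball' ?_))).trans
        (hD.four_mul hsν.1 hR)
      have := dist_triangle_right (e y) (e s) z
      linarith
    have hp := hD.pos hsν.1 hR
    have ht := hD.lt_top hsν.1 R
    rw [hw]
    simp only
    rw [← div_eq_mul_inv, ENNReal.le_div_iff_mul_le (Or.inl hpos.ne') (Or.inl htop.ne),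
      mul_comm, ← div_eq_mul_inv, ENNReal.div_le_iff hp.ne' ht.ne]
    exact h4
  calc ∫⁻ s in e ⁻¹' Metric.ball z R, w (e s) ∂ν
      ≤ ∫⁻ _ in e ⁻¹' Metric.ball z R, (C : ℝ≥0∞) ^ 2 *
          (μ (Metric.ball (e y) (2 * R) ∩ Ω))⁻¹ ∂ν := lintegral_mono_ae hwle
    _ = (C : ℝ≥0∞) ^ 2 * (μ (Metric.ball (e y) (2 * R) ∩ Ω))⁻¹ *
          ν (e ⁻¹' Metric.ball z R) := by rw [setLIntegral_const]
    _ ≤ (C : ℝ≥0∞) ^ 2 * (μ (Metric.ball (e y) (2 * R) ∩ Ω))⁻¹ *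
          (K * μ (Metric.ball (e y) (2 * R) ∩ Ω)) := by
        gcongr
        refine (measure_mono (preimage_mono (Metric.ball_subset_ball' ?_))).trans hyν
        rw [dist_comm]
        linarith
    _ = (C : ℝ≥0∞) ^ 2 * K * ((μ (Metric.ball (e y) (2 * R) ∩ Ω))⁻¹ *
          μ (Metric.ball (e y) (2 * R) ∩ Ω)) := by ring
    _ = _ := by rw [ENNReal.inv_mul_cancel hpos.ne' htop.ne, mul_one]

end Averages

/-! ### Inequalities for lower Lebesgue integrals -/

section Integral

variable {S : Type*} [MeasurableSpace S] {ν : Measure S}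

theorem setLAverage_mono_ae {s : Set S} {f g : S → ℝ≥0∞} (h : f ≤ᵐ[ν.restrict s] g) :
    ⨍⁻ z in s, f z ∂ν ≤ ⨍⁻ z in s, g z ∂ν := by
  rw [setLAverage_eq, setLAverage_eq]
  exact ENNReal.div_le_div_right (lintegral_mono_ae h) _

theorem setLAverage_add_left {s : Set S} {f : S → ℝ≥0∞} (hf : AEMeasurable f (ν.restrict s))
    (g : S → ℝ≥0∞) :
    ⨍⁻ z in s, (f z + g z) ∂ν = ⨍⁻ z in s, f z ∂ν + ⨍⁻ z in s, g z ∂ν := by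
  simp_rw [setLAverage_eq]
  rw [lintegral_add_left' hf, ENNReal.add_div]

theorem setLAverage_const_mul {s : Set S} {f : S → ℝ≥0∞} (hf : AEMeasurable f (ν.restrict s))
    (c : ℝ≥0∞) : ⨍⁻ z in s, c * f z ∂ν = c * ⨍⁻ z in s, f z ∂ν := by
  simp_rw [setLAverage_eq]
  rw [lintegral_const_mul'' _ hf, mul_div_assoc]

/-- Jensen's inequality for mean values. -/
theorem setLAverage_rpow_le {s : Set S} (h0 : ν s ≠ 0) (ht : ν s ≠ ∞) {p : ℝ} (hp : 1 ≤ p)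
    {f : S → ℝ≥0∞} (hf : AEMeasurable f (ν.restrict s)) :
    (⨍⁻ z in s, f z ∂ν) ^ p ≤ ⨍⁻ z in s, f z ^ p ∂ν := by
  have hp0 : 0 < p := zero_lt_one.trans_le hp
  have : IsFiniteMeasure (ν.restrict s) := ⟨by simpa using ht.lt_top⟩
  have : NeZero (ν.restrict s) := ⟨by simpa using h0⟩
  have hprob : IsProbabilityMeasure ((ν.restrict s univ)⁻¹ • ν.restrict s) := by
    infer_instance
  have h := eLpNorm'_le_eLpNorm'_of_exponent_le (f := f) one_pos hp
    ((ν.restrict s univ)⁻¹ • ν.restrict s) (hf.aestronglyMeasurable.smul_measure _)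
  simp only [eLpNorm', enorm_eq_self, ENNReal.rpow_one, div_one] at h
  have h' := ENNReal.rpow_le_rpow h hp0.le
  rwa [← ENNReal.rpow_mul, one_div_mul_cancel hp0.ne', ENNReal.rpow_one] at h'

/-- Minkowski's inequality for a series whose terms have `L^p` norm at most `K ^ (1 / p) * w j`. -/
theorem lintegral_tsum_rpow_le {p : ℝ} (hp : 1 ≤ p) {T : ℕ → S → ℝ≥0∞}
    (hT : ∀ j, AEMeasurable (T j) ν) {K : ℝ≥0∞} {w : ℕ → ℝ≥0∞}
    (h : ∀ j, ∫⁻ x, T j x ^ p ∂ν ≤ K * w j ^ p) :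
    ∫⁻ x, (∑' j, T j x) ^ p ∂ν ≤ K * (∑' j, w j) ^ p := by
  have hp0 : 0 < p := zero_lt_one.trans_le hp
  have hfin : ∀ n, (∫⁻ x, (∑ j ∈ Finset.range n, T j x) ^ p ∂ν) ^ (1 / p) ≤
      K ^ (1 / p) * ∑ j ∈ Finset.range n, w j := by
    intro n
    induction n with
    | zero => simp [hp0]
    | succ n ih =>
      simp_rw [Finset.sum_range_succ]
      refine (ENNReal.lintegral_Lp_add_le (f := fun x => ∑ j ∈ Finset.range n, T j x)
        (Finset.aemeasurable_fun_sum _ fun j _ => hT j) (hT n) hp).trans ?_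
      rw [mul_add]
      refine add_le_add ih ?_
      refine (ENNReal.rpow_le_rpow (h n) (by positivity)).trans_eq ?_
      rw [ENNReal.mul_rpow_of_nonneg _ _ (by positivity), ← ENNReal.rpow_mul,
        mul_one_div_cancel hp0.ne', ENNReal.rpow_one]
  have hfin' : ∀ n, ∫⁻ x, (∑ j ∈ Finset.range n, T j x) ^ p ∂ν ≤ K * (∑' j, w j) ^ p := by
    intro n
    have h1 := ENNReal.rpow_le_rpow (hfin n) hp0.le
    rw [← ENNReal.rpow_mul, one_div_mul_cancel hp0.ne', ENNReal.rpow_one,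
      ENNReal.mul_rpow_of_nonneg _ _ hp0.le, ← ENNReal.rpow_mul, one_div_mul_cancel hp0.ne',
      ENNReal.rpow_one] at h1
    refine h1.trans ?_
    gcongr
    exact ENNReal.sum_le_tsum _
  refine le_of_tendsto' (lintegral_tendsto_of_tendsto_of_monotone
    (f := fun n x => (∑ j ∈ Finset.range n, T j x) ^ p) (fun n => ?_) ?_ ?_) hfin'
  · exact (Finset.aemeasurable_fun_sum _ fun j _ => hT j).pow_const p
  · refine ae_of_all _ fun x m n hmn => ENNReal.rpow_le_rpow ?_ hp0.le
    exact Finset.sum_le_sum_of_subset (Finset.range_mono hmn)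
  · refine ae_of_all _ fun x => ?_
    exact ((ENNReal.continuous_rpow_const (y := p)).tendsto _).comp
      ENNReal.summable.hasSum.tendsto_sum_nat

theorem add_rpow_le {p : ℝ} (hp : 1 ≤ p) (a b : ℝ≥0∞) :
    (a + b) ^ p ≤ 2 ^ (p - 1) * (a ^ p + b ^ p) := by
  simpa using ENNReal.rpow_sum_le_const_mul_sum_rpow Finset.univ ![a, b] hp

theorem add_three_rpow_le {p : ℝ} (hp : 1 ≤ p) (a b c : ℝ≥0∞) :
    (a + b + c) ^ p ≤ 3 ^ (p - 1) * (a ^ p + b ^ p + c ^ p) := by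
  simpa [Fin.sum_univ_three] using
    ENNReal.rpow_sum_le_const_mul_sum_rpow Finset.univ ![a, b, c] hp

end Integral

/-! ### From weak upper gradients to upper gradients -/

section Gradient

variable {X Z : Type*} [MetricSpace X] [MeasurableSpace X] [MetricSpace Z]
  {μ : Measure X} {Ω : Set X} {p : ℝ}

/-- A curve family of modulus zero is made of curves along which a single function of small
`L^p` norm has infinite integral. -/
theorem exists_lineIntegral_eq_top (hp : 1 ≤ p) {Γ : Set (RectifiableCurve Ω)}
    (hΓ : modulus μ p Γ = 0) :
    ∃ ρ : X → ℝ≥0∞, Measurable ρ ∧ (∀ γ ∈ Γ, γ.lineIntegral ρ = ∞) ∧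
      ∫⁻ x in Ω, ρ x ^ p ∂μ ≤ 2 ^ p := by
  have hp0 : 0 < p := zero_lt_one.trans_le hp
  have h : ∀ n : ℕ, ∃ ρ : X → ℝ≥0∞, Measurable ρ ∧ (∀ γ ∈ Γ, 1 ≤ γ.lineIntegral ρ) ∧
      ∫⁻ x in Ω, ρ x ^ p ∂μ ≤ 1 * ((2⁻¹ : ℝ≥0∞) ^ n) ^ p := by
    intro n
    have hpos : modulus μ p Γ < 1 * ((2⁻¹ : ℝ≥0∞) ^ n) ^ p := by
      rw [hΓ, one_mul]
      exact ENNReal.rpow_pos (ENNReal.pow_pos (by simp) n) (by finiteness)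
    simp only [modulus, iInf_lt_iff] at hpos
    obtain ⟨ρ, hρ, hρΓ, hlt⟩ := hpos
    exact ⟨ρ, hρ, hρΓ, hlt.le⟩
  choose ρ hρ hρΓ hle using h
  refine ⟨fun x => ∑' n, ρ n x, Measurable.tsum hρ, fun γ hγ => ?_, ?_⟩
  · refine top_le_iff.1 ?_
    calc (∞ : ℝ≥0∞) = ∑' _ : ℕ, 1 := (ENNReal.tsum_const_eq_top_of_ne_zero one_ne_zero).symm
      _ ≤ ∑' n, γ.lineIntegral (ρ n) := ENNReal.tsum_le_tsum fun n => hρΓ n γ hγ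
      _ ≤ γ.lineIntegral fun x => ∑' n, ρ n x := by
        rw [ENNReal.tsum_eq_iSup_nat]
        refine iSup_le fun n => ?_
        have hsum : ∑ i ∈ Finset.range n, γ.lineIntegral (ρ i) ≤
            γ.lineIntegral fun x => ∑ i ∈ Finset.range n, ρ i x := by
          induction n with
          | zero => simp
          | succ n ih =>
            simp_rw [Finset.sum_range_succ]
            exact (add_le_add_left ih _).trans (le_lintegral_add _ _)
        exact hsum.trans (lintegral_mono fun t => ENNReal.sum_le_tsum _)
  · refine (lintegral_tsum_rpow_le hp (fun j => (hρ j).aemeasurable) hle).trans ?_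
    rw [ENNReal.tsum_geometric_two, one_mul]

/-- A `p`-weak upper gradient lies below an upper gradient whose energy is not much larger. -/
theorem IsWeakUpperGradient.exists_isUpperGradient (hp : 1 ≤ p) {u : X → Z} {g : X → ℝ≥0∞}
    (hg : IsWeakUpperGradient μ Ω p u g) :
    ∃ G : X → ℝ≥0∞, IsUpperGradient Ω u G ∧
      ∫⁻ x in Ω, G x ^ p ∂μ ≤ 2 ^ (p - 1) * (∫⁻ x in Ω, g x ^ p ∂μ + 2 ^ p) := by
  obtain ⟨ρ, hρ, hρΓ, hle⟩ := exists_lineIntegral_eq_top hp hg.2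
  refine ⟨fun x => g x + ρ x, ⟨hg.1.add hρ, fun γ => ?_⟩, ?_⟩
  · by_cases hγ : edist (u (γ.toFun γ.b)) (u (γ.toFun γ.a)) ≤ γ.lineIntegral g
    · exact hγ.trans (lintegral_mono fun t => le_self_add)
    · have h1 : γ.lineIntegral ρ ≤ γ.lineIntegral fun x => g x + ρ x :=
        lintegral_mono fun t => le_add_self
      rw [hρΓ γ hγ, top_le_iff] at h1
      rw [h1]
      exact le_top
  · calc ∫⁻ x in Ω, (g x + ρ x) ^ p ∂μ
        ≤ ∫⁻ x in Ω, 2 ^ (p - 1) * (g x ^ p + ρ x ^ p) ∂μ :=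
          lintegral_mono fun x => add_rpow_le hp _ _
      _ = 2 ^ (p - 1) * (∫⁻ x in Ω, g x ^ p ∂μ + ∫⁻ x in Ω, ρ x ^ p ∂μ) := by
          rw [lintegral_const_mul _ (f := fun x => g x ^ p + ρ x ^ p)
            ((hg.1.pow_const p).add (hρ.pow_const p)),
            lintegral_add_left (hg.1.pow_const p)]
      _ ≤ _ := by gcongr

theorem IsUpperGradient.isWeakUpperGradient (hp : 0 < p) {u : X → Z} {g : X → ℝ≥0∞}
    (hg : IsUpperGradient Ω u g) : IsWeakUpperGradient μ Ω p u g := by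
  refine ⟨hg.1, le_antisymm ?_ zero_le⟩
  refine (iInf_le _ (fun _ => 0)).trans ((iInf_le _ measurable_const).trans
    ((iInf_le _ fun γ hγ => absurd (hg.2 γ) hγ).trans ?_))
  simp [hp]

theorem IsUpperGradient.dist_const {u : X → Z} {g : X → ℝ≥0∞} (hg : IsUpperGradient Ω u g)
    (y : Z) : IsUpperGradient Ω (fun x => dist (u x) y) g := by
  refine ⟨hg.1, fun γ => le_trans ?_ (hg.2 γ)⟩
  rw [edist_dist, edist_dist, Real.dist_eq]
  exact ENNReal.ofReal_le_ofReal (abs_dist_sub_le _ _ _)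

theorem IsUpperGradient.dist {u v : X → Z} {g g' : X → ℝ≥0∞} (hg : IsUpperGradient Ω u g)
    (hg' : IsUpperGradient Ω v g') :
    IsUpperGradient Ω (fun x => dist (u x) (v x)) (fun x => g x + g' x) := by
  refine ⟨hg.1.add hg'.1, fun γ => ?_⟩
  refine le_trans ?_ ((add_le_add (hg.2 γ) (hg'.2 γ)).trans (le_lintegral_add _ _))
  rw [edist_dist, edist_dist, edist_dist, ← ENNReal.ofReal_add dist_nonneg dist_nonneg]
  exact ENNReal.ofReal_le_ofReal (dist_dist_dist_le _ _ _ _)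

end Gradient

/-! ### Limits of averages over shrinking balls -/

section Trace

variable {X Z : Type*} [MetricSpace X] [MeasurableSpace X] [MetricSpace Z]
  {μ : Measure X} {Ω : Set X} {C : ℝ≥0}

theorem setLAverage_edist_le {S : Type*} [MeasurableSpace S] {ν : Measure S} {s : Set S}
    (h0 : ν s ≠ 0) (ht : ν s ≠ ∞) (u : S → Z) (a b : Z) :
    ⨍⁻ z in s, edist (u z) b ∂ν ≤ ⨍⁻ z in s, edist (u z) a ∂ν + edist a b := by
  calc ⨍⁻ z in s, edist (u z) b ∂ν ≤ ⨍⁻ z in s, (edist (u z) a + edist a b) ∂ν :=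
        setLAverage_mono_ae (ae_of_all _ fun z => edist_triangle _ _ _)
    _ = _ := by
        simp_rw [add_comm _ (edist a b)]
        rw [setLAverage_add_left aemeasurable_const, setLAverage_const h0 ht]

theorem edist_le_setLAverage_add {S : Type*} [MeasurableSpace S] {ν : Measure S} {s : Set S}
    (h0 : ν s ≠ 0) (ht : ν s ≠ ∞) {u : S → Z} (hu : AEStronglyMeasurable u (ν.restrict s))
    (a b : Z) :
    edist a b ≤ ⨍⁻ z in s, edist (u z) a ∂ν + ⨍⁻ z in s, edist (u z) b ∂ν := by
  rw [← setLAverage_add_left (hu.edist aestronglyMeasurable_const),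
    ← setLAverage_const h0 ht (edist a b)]
  exact setLAverage_mono_ae (ae_of_all _ fun z => edist_triangle_left _ _ _)

theorem tendsto_div_two_pow (r : ℝ) (hr : 0 < r) :
    Tendsto (fun j : ℕ => r / 2 ^ j) atTop (𝓝[>] 0) := by
  refine tendsto_nhdsWithin_iff.2 ⟨?_, Eventually.of_forall fun j => by
    simp only [mem_Ioi]; positivity⟩
  simpa [div_eq_mul_inv] using
    (tendsto_pow_atTop_nhds_zero_of_lt_one (r := (2 : ℝ)⁻¹) (by norm_num) (by norm_num)).const_mul r

theorem IsTraceAt.unique (hD : IsDoublingWith μ Ω C) {u : X → Z}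
    (hu : AEStronglyMeasurable u (μ.restrict Ω)) {x : X} (hx : x ∈ closure Ω) {a b : Z}
    (ha : IsTraceAt μ Ω u x a) (hb : IsTraceAt μ Ω u x b) : a = b := by
  rw [← edist_le_zero]
  have h := ha.add hb
  rw [add_zero] at h
  refine ge_of_tendsto h (eventually_mem_nhdsWithin.mono fun r hr => ?_)
  exact edist_le_setLAverage_add (hD.pos hx hr).ne' (hD.lt_top hx r).ne
    (hu.mono_measure (Measure.restrict_mono inter_subset_right le_rfl)) a b

/-- By doubling, traces can be computed along dyadic radii. -/
theorem IsDoublingWith.isTraceAt_of_dyadic (hD : IsDoublingWith μ Ω C) {u : X → Z} {x : X}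
    (hx : x ∈ closure Ω) {y : Z} {r : ℝ} (hr : 0 < r)
    (h : Tendsto (fun j : ℕ => ⨍⁻ z in Metric.ball x (r / 2 ^ j) ∩ Ω, edist (u z) y ∂μ) atTop
      (𝓝 0)) : IsTraceAt μ Ω u x y := by
  have h' : Tendsto (fun j : ℕ => (C : ℝ≥0∞) ^ 2 *
      ⨍⁻ z in Metric.ball x (r / 2 ^ j) ∩ Ω, edist (u z) y ∂μ) atTop (𝓝 0) := by
    simpa using ENNReal.Tendsto.const_mul h (Or.inr (by finiteness))
  rw [IsTraceAt, ENNReal.tendsto_nhds_zero]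
  intro ε hε
  obtain ⟨J, hJ⟩ := eventually_atTop.1 (ENNReal.tendsto_nhds_zero.1 h' ε hε)
  filter_upwards [Ioo_mem_nhdsGT (show (0 : ℝ) < r / 2 ^ J by positivity)] with s hs
  have hrJ : r / 2 ^ J ≤ r := div_le_self hr.le (one_le_pow₀ (by norm_num))
  obtain ⟨n, hn1, hn2⟩ := exists_nat_pow_near_of_lt_one (x := s / r) (y := (2 : ℝ)⁻¹)
    (div_pos hs.1 hr) ((div_le_one hr).2 (hs.2.le.trans hrJ)) (by norm_num) (by norm_num)
  have hn1' : r / 2 ^ (n + 1) < s := by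
    rw [lt_div_iff₀ hr, inv_pow] at hn1
    rwa [div_eq_mul_inv, mul_comm]
  have hn2' : s ≤ r / 2 ^ n := by
    rw [div_le_iff₀ hr, inv_pow] at hn2
    rwa [div_eq_mul_inv, mul_comm]
  have hJn : J ≤ n := by
    by_contra! hlt
    have : r / 2 ^ J ≤ r / 2 ^ (n + 1) :=
      div_le_div_of_nonneg_left hr.le (by positivity) (pow_le_pow_right₀ (by norm_num) hlt)
    linarith [hs.2]
  refine (hD.laverage_le hx hs.1
    (inter_subset_left.trans (Metric.ball_subset_ball hn2'))
    (inter_subset_left.trans (Metric.ball_subset_ball ?_)) _).trans (hJ n hJn)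
  have : r / 2 ^ n = 2 * (r / 2 ^ (n + 1)) := by rw [pow_succ]; field_simp
  linarith [hs.1]

/-- If `u` is on average `τ j`-close to `a j` in the `j`-th dyadic ball around `x`, then consecutive
`a j` are close. -/
theorem IsDoublingWith.edist_succ_le (hD : IsDoublingWith μ Ω C) {u : X → Z}
    (hu : AEStronglyMeasurable u (μ.restrict Ω)) {x : X} (hx : x ∈ closure Ω) {r : ℝ} (hr : 0 < r)
    {a : ℕ → Z} {τ : ℕ → ℝ≥0∞}
    (h : ∀ j, ⨍⁻ z in Metric.ball x (r / 2 ^ j) ∩ Ω, edist (u z) (a j) ∂μ ≤ τ j) (j : ℕ) :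
    edist (a j) (a (j + 1)) ≤ (C : ℝ≥0∞) ^ 2 * τ j + τ (j + 1) := by
  have hr' : 0 < r / 2 ^ (j + 1) := by positivity
  have h2 : r / 2 ^ j = 2 * (r / 2 ^ (j + 1)) := by rw [pow_succ]; field_simp
  refine (edist_le_setLAverage_add (hD.pos hx hr').ne' (hD.lt_top hx _).ne
    (hu.mono_measure (Measure.restrict_mono inter_subset_right le_rfl)) _ _).trans
    (add_le_add ?_ (h (j + 1)))
  refine (hD.laverage_le hx hr' (inter_subset_left.trans (Metric.ball_subset_ball ?_))
    (inter_subset_left.trans (Metric.ball_subset_ball ?_)) _).trans (by gcongr; exact h j) <;>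
  linarith

theorem tsum_mul_add_succ_le (c : ℝ≥0∞) (τ : ℕ → ℝ≥0∞) :
    ∑' j, (c * τ j + τ (j + 1)) ≤ (c + 1) * ∑' j, τ j := by
  rw [ENNReal.tsum_add, ENNReal.tsum_mul_left, add_mul, one_mul]
  exact add_le_add le_rfl (ENNReal.tsum_comp_le_tsum_of_injective (add_left_injective 1) τ)

theorem tendsto_zero_of_tsum_ne_top {τ : ℕ → ℝ≥0∞} (h : ∑' j, τ j ≠ ∞) :
    Tendsto τ atTop (𝓝 0) := by
  simpa [Nat.cofinite_eq_atTop] using ENNReal.tendsto_cofinite_zero_of_tsum_ne_top h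

theorem IsDoublingWith.tendsto_of_isTraceAt (hD : IsDoublingWith μ Ω C) {u : X → Z}
    (hu : AEStronglyMeasurable u (μ.restrict Ω)) {x : X} (hx : x ∈ closure Ω) {r : ℝ} (hr : 0 < r)
    {a : ℕ → Z} {τ : ℕ → ℝ≥0∞}
    (h : ∀ j, ⨍⁻ z in Metric.ball x (r / 2 ^ j) ∩ Ω, edist (u z) (a j) ∂μ ≤ τ j)
    (hτ : Tendsto τ atTop (𝓝 0)) {y : Z} (hy : IsTraceAt μ Ω u x y) :
    Tendsto a atTop (𝓝 y) := by
  rw [tendsto_iff_edist_tendsto_0]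
  have h1 := hτ.add (hy.comp (tendsto_div_two_pow r hr))
  rw [add_zero] at h1
  refine tendsto_of_tendsto_of_tendsto_of_le_of_le tendsto_const_nhds h1 (fun _ => zero_le)
    fun j => ?_
  have hr' : 0 < r / 2 ^ j := by positivity
  exact (edist_le_setLAverage_add (hD.pos hx hr').ne' (hD.lt_top hx _).ne
    (hu.mono_measure (Measure.restrict_mono inter_subset_right le_rfl)) _ _).trans
    (add_le_add (h j) le_rfl)

/-- Telescoping over dyadic balls. -/
theorem IsDoublingWith.edist_le_tsum (hD : IsDoublingWith μ Ω C) {u : X → Z}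
    (hu : AEStronglyMeasurable u (μ.restrict Ω)) {x : X} (hx : x ∈ closure Ω) {r : ℝ} (hr : 0 < r)
    {a : ℕ → Z} {τ : ℕ → ℝ≥0∞}
    (h : ∀ j, ⨍⁻ z in Metric.ball x (r / 2 ^ j) ∩ Ω, edist (u z) (a j) ∂μ ≤ τ j)
    {y : Z} (hy : IsTraceAt μ Ω u x y) :
    edist (a 0) y ≤ ((C : ℝ≥0∞) ^ 2 + 1) * ∑' j, τ j := by
  by_cases hτ : ∑' j, τ j = ∞
  · rw [hτ, ENNReal.mul_top (by simp)]
    exact le_top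
  · exact (edist_le_tsum_of_edist_le_of_tendsto₀ _ (hD.edist_succ_le hu hx hr h)
      (hD.tendsto_of_isTraceAt hu hx hr h (tendsto_zero_of_tsum_ne_top hτ) hy)).trans
      (tsum_mul_add_succ_le _ _)

/-- In a complete target, summability of the oscillations over dyadic balls gives a trace. -/
theorem IsDoublingWith.exists_isTraceAt [CompleteSpace Z] (hD : IsDoublingWith μ Ω C) {u : X → Z}
    (hu : AEStronglyMeasurable u (μ.restrict Ω)) {x : X} (hx : x ∈ closure Ω) {r : ℝ} (hr : 0 < r)
    {a : ℕ → Z} {τ : ℕ → ℝ≥0∞}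
    (h : ∀ j, ⨍⁻ z in Metric.ball x (r / 2 ^ j) ∩ Ω, edist (u z) (a j) ∂μ ≤ τ j)
    (hτ : ∑' j, τ j ≠ ∞) : ∃ y, IsTraceAt μ Ω u x y := by
  have hsum : ∑' j, ((C : ℝ≥0∞) ^ 2 * τ j + τ (j + 1)) ≠ ∞ :=
    ((tsum_mul_add_succ_le _ _).trans_lt
      (ENNReal.mul_lt_top (by finiteness) (lt_top_iff_ne_top.2 hτ))).ne
  obtain ⟨y, hy⟩ := cauchySeq_tendsto_of_complete
    (cauchySeq_of_edist_le_of_tsum_ne_top _ (hD.edist_succ_le hu hx hr h) hsum)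
  refine ⟨y, hD.isTraceAt_of_dyadic hx hr ?_⟩
  have h1 := (tendsto_zero_of_tsum_ne_top hτ).add (tendsto_iff_edist_tendsto_0.1 hy)
  rw [add_zero] at h1
  refine tendsto_of_tendsto_of_tendsto_of_le_of_le tendsto_const_nhds h1 (fun _ => zero_le)
    fun j => ?_
  have hr' : 0 < r / 2 ^ j := by positivity
  exact (setLAverage_edist_le (hD.pos hx hr').ne' (hD.lt_top hx _).ne u (a j) y).trans
    (add_le_add (h j) le_rfl)

/-- Lebesgue's differentiation theorem on `Ω`. It is obtained from the one for uniformly locally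
doubling measures on the separable metric space `Ω`; open and closed balls are interchangeable by
doubling. -/
theorem IsDoublingWith.ae_isTraceAt [BorelSpace X] (hD : IsDoublingWith μ Ω C)
    (hΩ : MeasurableSet Ω) (hb : Bornology.IsBounded Ω) {f : X → ℝ} (hf : IntegrableOn f Ω μ) :
    ∀ᵐ x ∂μ.restrict Ω, IsTraceAt μ Ω f x (f x) := by
  have := hD.secondCountableTopology hΩ hb
  set m : Measure Ω := μ.comap Subtype.val with hm
  have hmE : ∀ s : Set X, m (Subtype.val ⁻¹' s) = μ (s ∩ Ω) := by
    intro s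
    rw [hm, comap_subtype_coe_apply hΩ, Subtype.image_preimage_coe, inter_comm]
  have hmb : ∀ (x : Ω) (r : ℝ), m (Metric.ball x r) = μ (Metric.ball (x : X) r ∩ Ω) :=
    fun x r => hmE (Metric.ball (x : X) r)
  have : IsFiniteMeasure m := ⟨by
    have := hmE univ
    rw [preimage_univ, univ_inter] at this
    rw [this]
    exact hD.measure_lt_top hb⟩
  have : IsUnifLocDoublingMeasure m := ⟨C ^ 2, eventually_mem_nhdsWithin.mono fun ε hε x => by
    have hε : 0 < ε := hε
    calc m (Metric.closedBall x (2 * ε)) ≤ m (Metric.ball x (4 * ε)) :=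
          measure_mono (Metric.closedBall_subset_ball (by linarith))
      _ ≤ (C : ℝ≥0∞) ^ 2 * m (Metric.ball x ε) := by
          rw [hmb, hmb]; exact hD.four_mul (subset_closure x.2) hε
      _ ≤ _ := by
          rw [ENNReal.coe_pow]
          gcongr
          exact Metric.ball_subset_closedBall⟩
  have hfm : Integrable (fun x : Ω => f x) m := by
    have := (MeasurableEmbedding.subtype_coe hΩ).integrable_map_iff (μ := m) (g := f)
    rw [hm, map_comap_subtype_coe hΩ] at this
    exact this.1 hf
  rw [ae_restrict_iff_subtype hΩ]
  filter_upwards [IsUnifLocDoublingMeasure.ae_tendsto_average_norm_sub m hfm.locallyIntegrable 1]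
    with x hx
  have h1 := ENNReal.tendsto_ofReal (hx (l := 𝓝[>] (0 : ℝ)) (fun _ => x) id tendsto_id
    (eventually_mem_nhdsWithin.mono fun r hr => Metric.mem_closedBall_self (by
      simpa using (show (0 : ℝ) < r from hr).le)))
  have h2 := ENNReal.Tendsto.const_mul h1 (a := (C : ℝ≥0∞)) (Or.inr (by finiteness))
  rw [ENNReal.ofReal_zero, mul_zero] at h2
  refine tendsto_of_tendsto_of_tendsto_of_le_of_le' tendsto_const_nhds h2
    (Eventually.of_forall fun _ => zero_le) (eventually_mem_nhdsWithin.mono fun r hr => ?_)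
  have hr : 0 < r := hr
  simp only [id]
  have hfx : Integrable (fun y : Ω => ‖f y - f x‖) m := (hfm.sub (integrable_const _)).norm
  rw [ofReal_setAverage hfx.integrableOn (ae_of_all _ fun y => norm_nonneg _), setLAverage_eq,
    ← hmb, ← mul_div_assoc]
  have hp : 0 < m (Metric.ball x r) := by rw [hmb]; exact hD.pos (subset_closure x.2) hr
  have hp' : 0 < m (Metric.closedBall x r) :=
    hp.trans_le (measure_mono Metric.ball_subset_closedBall)
  rw [ENNReal.div_le_iff hp.ne' (measure_ne_top _ _), ENNReal.mul_div_right_comm,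
    mul_right_comm, ← ENNReal.mul_div_right_comm]
  have hnum : ∫⁻ z in Metric.ball (x : X) r ∩ Ω, edist (f z) (f x) ∂μ ≤
      ∫⁻ y in Metric.closedBall x r, ENNReal.ofReal ‖f y - f x‖ ∂m := by
    calc ∫⁻ z in Metric.ball (x : X) r ∩ Ω, edist (f z) (f x) ∂μ
        = ∫⁻ y in Metric.ball x r, ENNReal.ofReal ‖f y - f x‖ ∂m := by
          rw [← Measure.restrict_restrict Metric.isOpen_ball.measurableSet,
            ← map_comap_subtype_coe hΩ,
            (MeasurableEmbedding.subtype_coe hΩ).restrict_map,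
            (MeasurableEmbedding.subtype_coe hΩ).lintegral_map]
          refine lintegral_congr fun y => ?_
          rw [edist_dist, Real.dist_eq, Real.norm_eq_abs]
      _ ≤ _ := lintegral_mono_set Metric.ball_subset_closedBall
  have hden : m (Metric.closedBall x r) ≤ C * m (Metric.ball x r) := by
    refine (measure_mono (Metric.closedBall_subset_ball (show r < 2 * r by linarith))).trans ?_
    rw [hmb, hmb]
    exact (hD x (subset_closure x.2) r hr).2.1
  refine hnum.trans ?_
  rw [mul_comm (C * m (Metric.ball x r) / _)]
  refine le_mul_of_one_le_right zero_le ?_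
  rw [ENNReal.le_div_iff_mul_le (Or.inl hp'.ne') (Or.inl (measure_ne_top _ _)), one_mul]
  exact hden

end Trace

/-! ### The dyadic potential and pointwise estimates in the domain -/

/-- The dyadic potential `∑ i, r_i (⨍_{B(z, λ r_i) ∩ Ω} g ^ p) ^ (1 / p)` with `r_i = r / 2 ^ i`.
It dominates the oscillation of a Sobolev map with upper gradient `g` at scale `r`. -/
def potential {X : Type*} [MetricSpace X] [MeasurableSpace X] (μ : Measure X) (Ω : Set X)
    (p lam : ℝ) (g : X → ℝ≥0∞) (r : ℝ) (z : X) : ℝ≥0∞ :=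
  ∑' i : ℕ, ENNReal.ofReal (r / 2 ^ i) *
    (⨍⁻ y in Metric.ball z (lam * (r / 2 ^ i)) ∩ Ω, g y ^ p ∂μ) ^ (1 / p)

/-- The local `p`-Poincaré inequality with explicit constants, for functions integrable on `Ω`. -/
def HasPoincareWith {X : Type*} [MetricSpace X] [MeasurableSpace X] (μ : Measure X) (Ω : Set X)
    (p : ℝ) (K : ℝ≥0) (lam : ℝ) : Prop :=
  ∀ x ∈ Ω, ∀ r : ℝ, 0 < r → ∀ (u : X → ℝ) (g : X → ℝ≥0∞), IntegrableOn u Ω μ →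
    IsUpperGradient Ω u g →
    ⨍⁻ y in Metric.ball x r ∩ Ω, edist (u y) (⨍ z in Metric.ball x r ∩ Ω, u z ∂μ) ∂μ ≤
      K * (ENNReal.ofReal r * (⨍⁻ y in Metric.ball x (lam * r) ∩ Ω, g y ^ p ∂μ) ^ (1 / p))

theorem ofReal_div_two_pow {r : ℝ} (hr : 0 ≤ r) (j : ℕ) :
    ENNReal.ofReal (r / 2 ^ j) = ENNReal.ofReal r * 2⁻¹ ^ j := by
  rw [div_eq_mul_inv, ENNReal.ofReal_mul hr, ← inv_pow, ENNReal.ofReal_pow (by norm_num),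
    ENNReal.ofReal_inv_of_pos two_pos, ENNReal.ofReal_ofNat]

theorem tsum_ofReal_div_two_pow {r : ℝ} (hr : 0 ≤ r) :
    ∑' j : ℕ, ENNReal.ofReal (r / 2 ^ j) = ENNReal.ofReal r * 2 := by
  simp_rw [ofReal_div_two_pow hr]
  rw [ENNReal.tsum_mul_left, ENNReal.tsum_geometric_two]

theorem integrableOn_dist {S Y : Type*} [MeasurableSpace S] [MetricSpace Y] {μ : Measure S}
    {Ω : Set S} {p : ℝ} (hμ : μ Ω < ∞) (hp : 1 ≤ p) {u : S → Y}
    (hu : MemLpMetric (μ.restrict Ω) p u) (y : Y) :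
    IntegrableOn (fun x => dist (u x) y) Ω μ := by
  obtain ⟨hum, z₀, hz₀⟩ := hu
  refine ⟨hum.dist aestronglyMeasurable_const, ?_⟩
  rw [HasFiniteIntegral]
  calc ∫⁻ x in Ω, ‖dist (u x) y‖ₑ ∂μ
      ≤ ∫⁻ x in Ω, (edist (u x) z₀ ^ p + (1 + edist z₀ y)) ∂μ := by
        refine lintegral_mono fun x => ?_
        rw [Real.enorm_of_nonneg dist_nonneg, ← edist_dist]
        refine (edist_triangle _ z₀ _).trans ?_
        rw [← add_assoc]
        gcongr
        rcases le_total (edist (u x) z₀) 1 with h | h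
        · exact h.trans le_add_self
        · refine le_trans ?_ le_self_add
          simpa using ENNReal.rpow_le_rpow_of_exponent_le h hp
    _ = ∫⁻ x in Ω, edist (u x) z₀ ^ p ∂μ + (1 + edist z₀ y) * μ Ω := by
        rw [lintegral_add_right _ measurable_const, setLIntegral_const]
    _ < ∞ := ENNReal.add_lt_top.2 ⟨hz₀, ENNReal.mul_lt_top (by finiteness) hμ⟩

section Interior

variable {X : Type*} [MetricSpace X] [MeasurableSpace X] {μ : Measure X} {Ω : Set X} {C K : ℝ≥0}
  {p lam : ℝ} {g : X → ℝ≥0∞}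

theorem le_potential (r : ℝ) (z : X) :
    ENNReal.ofReal r * (⨍⁻ y in Metric.ball z (lam * r) ∩ Ω, g y ^ p ∂μ) ^ (1 / p) ≤
      potential μ Ω p lam g r z := by
  refine le_trans (le_of_eq ?_) (ENNReal.le_tsum 0)
  simp

theorem measurable_potential [BorelSpace X] [SFinite (μ.restrict Ω)] (hΩ : MeasurableSet Ω)
    (hsep : SecondCountableTopology Ω) (hg : Measurable g) (r : ℝ) :
    Measurable (potential μ Ω p lam g r) :=
  Measurable.tsum fun _ => (((measurable_laverage_ball hΩ hsep _
    (hg.pow_const p).aemeasurable).pow_const _).const_mul _)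

theorem IsDoublingWith.lintegral_potential_rpow_le [BorelSpace X] [SFinite (μ.restrict Ω)]
    (hD : IsDoublingWith μ Ω C) (hΩ : MeasurableSet Ω)
    (hsep : SecondCountableTopology Ω) (hp : 1 ≤ p) (hlam : 1 ≤ lam) (hg : Measurable g) {r : ℝ}
    (hr : 0 < r) :
    ∫⁻ z in Ω, potential μ Ω p lam g r z ^ p ∂μ ≤
      (C : ℝ≥0∞) ^ 2 * (∫⁻ z in Ω, g z ^ p ∂μ) * (ENNReal.ofReal r * 2) ^ p := by
  have hp0 : 0 < p := zero_lt_one.trans_le hp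
  rw [← tsum_ofReal_div_two_pow hr.le]
  refine lintegral_tsum_rpow_le hp (fun i => (((measurable_laverage_ball hΩ hsep _
    (hg.pow_const p).aemeasurable).pow_const _).const_mul _).aemeasurable) fun i => ?_
  simp_rw [ENNReal.mul_rpow_of_nonneg _ _ hp0.le, ← ENNReal.rpow_mul, one_div_mul_cancel hp0.ne',
    ENNReal.rpow_one]
  rw [lintegral_const_mul _ (measurable_laverage_ball hΩ hsep _ (hg.pow_const p).aemeasurable),
    mul_comm]
  gcongr
  have hri : 0 < lam * (r / 2 ^ i) := by positivity
  refine (hD.lintegral_laverage_le hΩ hsep (μ.restrict Ω) measurable_id hri (K := 1) ?_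
    (hg.pow_const p).aemeasurable).trans_eq (by rw [mul_one])
  filter_upwards [ae_restrict_mem hΩ] with z hz
  refine ⟨subset_closure hz, ?_⟩
  rw [preimage_id, Measure.restrict_apply Metric.isOpen_ball.measurableSet, one_mul, id]

/-- At a Lebesgue point the deviation of a Sobolev function from its mean is controlled by the
potential. -/
theorem IsDoublingWith.edist_setAverage_le (hD : IsDoublingWith μ Ω C)
    (hP : HasPoincareWith μ Ω p K lam) {f : X → ℝ} (hf : IntegrableOn f Ω μ)
    (hg : IsUpperGradient Ω f g) {z : X} (hz : z ∈ Ω) (hfz : IsTraceAt μ Ω f z (f z)) {r : ℝ}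
    (hr : 0 < r) :
    edist (⨍ y in Metric.ball z r ∩ Ω, f y ∂μ) (f z) ≤
      ((C : ℝ≥0∞) ^ 2 + 1) * (K * potential μ Ω p lam g r z) := by
  have h := hD.edist_le_tsum hf.aestronglyMeasurable (subset_closure hz) hr
    (fun j => hP z hz (r / 2 ^ j) (by positivity) f g hf hg) hfz
  rwa [ENNReal.tsum_mul_left, pow_zero, div_one] at h

theorem IsDoublingWith.edist_setAverage_setAverage_le (hD : IsDoublingWith μ Ω C)
    (hP : HasPoincareWith μ Ω p K lam) {f : X → ℝ} (hf : IntegrableOn f Ω μ)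
    (hg : IsUpperGradient Ω f g) {z w : X} (hz : z ∈ Ω) (hw : w ∈ Ω) {r : ℝ} (hr : 0 < r)
    (hzw : dist z w < 2 * r) :
    edist (⨍ y in Metric.ball z (4 * r) ∩ Ω, f y ∂μ) (⨍ y in Metric.ball w (4 * r) ∩ Ω, f y ∂μ) ≤
      (C : ℝ≥0∞) ^ 2 * (K * potential μ Ω p lam g (4 * r) z) +
      (C : ℝ≥0∞) ^ 2 * (K * potential μ Ω p lam g (4 * r) w) := by
  have hr2 : 0 < 2 * r := by positivity
  have hzc := subset_closure hz
  refine (edist_le_setLAverage_add (hD.pos hzc hr2).ne' (hD.lt_top hzc _).ne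
    (hf.aestronglyMeasurable.mono_measure (Measure.restrict_mono inter_subset_right le_rfl))
    _ _).trans (add_le_add ?_ ?_)
  · refine (hD.laverage_le hzc hr2 (inter_subset_left.trans (Metric.ball_subset_ball ?_))
      (inter_subset_left.trans (Metric.ball_subset_ball ?_)) _).trans (mul_le_mul_right
        ((hP z hz (4 * r) (by positivity) f g hf hg).trans (mul_le_mul_right (le_potential _ _) _))
        _) <;>
    linarith
  · refine (hD.laverage_le hzc hr2 (inter_subset_left.trans (Metric.ball_subset_ball' ?_))
      (inter_subset_left.trans (Metric.ball_subset_ball' ?_)) _).trans (mul_le_mul_right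
        ((hP w hw (4 * r) (by positivity) f g hf hg).trans (mul_le_mul_right (le_potential _ _) _))
        _)
    · linarith
    · rw [dist_comm]; linarith

theorem IsDoublingWith.edist_le_potential_real (hD : IsDoublingWith μ Ω C)
    (hP : HasPoincareWith μ Ω p K lam) {f : X → ℝ} (hf : IntegrableOn f Ω μ)
    (hg : IsUpperGradient Ω f g) {z w : X} (hz : z ∈ Ω) (hw : w ∈ Ω)
    (hfz : IsTraceAt μ Ω f z (f z)) (hfw : IsTraceAt μ Ω f w (f w)) {r : ℝ} (hr : 0 < r)
    (hzw : dist z w < 2 * r) :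
    edist (f z) (f w) ≤ (2 * (C : ℝ≥0∞) ^ 2 + 1) * K *
      (potential μ Ω p lam g (4 * r) z + potential μ Ω p lam g (4 * r) w) := by
  have hr4 : 0 < 4 * r := by positivity
  have h1 := hD.edist_setAverage_le hP hf hg hz hfz hr4
  have h2 := hD.edist_setAverage_setAverage_le hP hf hg hz hw hr hzw
  have h3 := hD.edist_setAverage_le hP hf hg hw hfw hr4
  rw [edist_comm] at h1
  refine (edist_triangle4 _ _ _ _).trans ((add_le_add (add_le_add h1 h2) h3).trans_eq ?_)
  ring

/-- A metric valued Sobolev map satisfies a pointwise estimate of Hajłasz type: away from a null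
set, distances of values are controlled by the potential of an upper gradient. The Poincaré
inequality, known only for real functions, is applied to the distances from a countable dense
subset of the essential range. -/
theorem IsDoublingWith.exists_forall_edist_le_potential [BorelSpace X] (hD : IsDoublingWith μ Ω C)
    (hP : HasPoincareWith μ Ω p K lam) (hΩ : MeasurableSet Ω) (hb : Bornology.IsBounded Ω)
    (hp : 1 ≤ p) {Y : Type*} [MetricSpace Y] {u : X → Y} (hu : MemLpMetric (μ.restrict Ω) p u)
    (hg : IsUpperGradient Ω u g) :
    ∃ s ⊆ Ω, (∀ᵐ z ∂μ.restrict Ω, z ∈ s) ∧ ∀ z ∈ s, ∀ w ∈ s, ∀ r : ℝ, 0 < r → dist z w < 2 * r →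
      edist (u z) (u w) ≤ (2 * (C : ℝ≥0∞) ^ 2 + 1) * K *
        (potential μ Ω p lam g (4 * r) z + potential μ Ω p lam g (4 * r) w) := by
  obtain ⟨t, ⟨c, hc, htc⟩, hut⟩ := hu.1.isSeparable_ae_range
  have hint := integrableOn_dist (hD.measure_lt_top hb) hp hu
  refine ⟨{z | z ∈ Ω ∧ u z ∈ t ∧
    ∀ y ∈ c, IsTraceAt μ Ω (fun x => dist (u x) y) z (dist (u z) y)}, fun z hz => hz.1, ?_, ?_⟩
  · filter_upwards [ae_restrict_mem hΩ, hut, (ae_ball_iff hc).2 fun y _ =>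
      hD.ae_isTraceAt hΩ hb (hint y)] with z h1 h2 h3 using ⟨h1, h2, h3⟩
  · rintro z ⟨hz, huz, hzc⟩ w ⟨hw, -, hwc⟩ r hr hzw
    refine ENNReal.le_of_forall_pos_le_add fun ε hε _ => ?_
    obtain ⟨y, hy, hyε⟩ := Metric.mem_closure_iff.1 (htc huz) (ε / 2) (by positivity)
    have h1 := hD.edist_le_potential_real hP (hint y) (hg.dist_const y) hz hw (hzc y hy)
      (hwc y hy) hr hzw
    refine le_trans ?_ (add_le_add h1 le_rfl)
    rw [edist_dist, edist_dist, Real.dist_eq, ← ENNReal.ofReal_coe_nnreal,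
      ← ENNReal.ofReal_add (abs_nonneg _) ε.coe_nonneg]
    refine ENNReal.ofReal_le_ofReal ?_
    have h2 := neg_abs_le (dist (u z) y - dist (u w) y)
    have h3 := dist_triangle_right (u z) (u w) y
    linarith

end Interior

/-! ### Estimates at the boundary -/

/-- Weak `(p, θ)`-admissibility of a bounded open set with explicit constants; the codimension
bound is only recorded for radii up to some `R > 0`. -/
structure IsWeaklyAdmissibleWith {X : Type*} [MetricSpace X] [MeasurableSpace X] (μ : Measure X)
    (Ω : Set X) (H : Measure (frontier Ω)) (p θ : ℝ) (C K CH : ℝ≥0) (lam R : ℝ) : Prop where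
  isOpen : IsOpen Ω
  isBounded : Bornology.IsBounded Ω
  one_lt : 1 < p
  theta_lt : θ < p
  one_le_lam : 1 ≤ lam
  R_pos : 0 < R
  doubling : IsDoublingWith μ Ω C
  poincare : HasPoincareWith μ Ω p K lam
  codim : ∀ x : frontier Ω, ∀ r : ℝ, 0 < r → r ≤ R →
    H (Metric.ball x r) ≤ CH / ENNReal.ofReal (r ^ θ) * μ (Metric.ball (x : X) r ∩ Ω)

theorem diam_pos_of_mem_frontier {X : Type*} [MetricSpace X] {Ω : Set X} (hΩ : IsOpen Ω)
    (hb : Bornology.IsBounded Ω) {x : X} (hx : x ∈ frontier Ω) : 0 < Metric.diam Ω := by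
  have hxΩ : x ∉ Ω := fun h => by
    rw [hΩ.frontier_eq] at hx
    exact hx.2 h
  obtain ⟨z, hz, -⟩ := Metric.mem_closure_iff.1 (frontier_subset_closure hx) 1 one_pos
  have hxz : 0 < dist x z := dist_pos.2 fun h => hxΩ (h ▸ hz)
  obtain ⟨w, hw, hxw⟩ := Metric.mem_closure_iff.1 (frontier_subset_closure hx) _ hxz
  have hzw : 0 < dist z w := dist_pos.2 fun h => hxw.ne (h ▸ rfl)
  exact hzw.trans_le (Metric.dist_le_diam_of_mem hb hz hw)

theorem IsWeaklyAdmissible.exists_with {X : Type*} [MetricSpace X] [MeasurableSpace X]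
    {μ : Measure X} {Ω : Set X} {H : Measure (frontier Ω)} {p θ : ℝ}
    (h : IsWeaklyAdmissible μ Ω H p θ) (hΩ : IsOpen Ω) (hb : Bornology.IsBounded Ω) :
    ∃ (C K CH : ℝ≥0) (lam R : ℝ), IsWeaklyAdmissibleWith μ Ω H p θ C K CH lam R := by
  obtain ⟨C, hC⟩ := h.doubling
  obtain ⟨K, lam, hlam, hK⟩ := h.poincare
  obtain ⟨CH, hCH⟩ := h.codim
  have hP : HasPoincareWith μ Ω p K lam := fun x hx r hr u g hu hg => by
    rw [← mul_assoc]
    exact hK x hx r hr u g hu.locallyIntegrableOn (hu.mono_set inter_subset_right) hg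
  have hR : ∃ R : ℝ, 0 < R ∧ ∀ x : frontier Ω, ∀ r : ℝ, 0 < r → r ≤ R →
      H (Metric.ball x r) ≤ CH / ENNReal.ofReal (r ^ θ) * μ (Metric.ball (x : X) r ∩ Ω) := by
    rcases isEmpty_or_nonempty (frontier Ω) with he | ⟨⟨x₀, hx₀⟩⟩
    · exact ⟨1, one_pos, fun x => he.elim x⟩
    · refine ⟨Metric.diam Ω, diam_pos_of_mem_frontier hΩ hb hx₀, fun x r hr hrR =>
        (hCH x r hr hrR).trans_eq ?_⟩
      rw [← mul_div_assoc, ENNReal.mul_div_right_comm]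
  obtain ⟨R, hR0, hR⟩ := hR
  exact ⟨C, K, CH, lam, R, hΩ, hb, h.one_lt, h.theta_lt, hlam, hR0, hC, hP, hR⟩

/-- The sum over dyadic balls around `x` of the averages of the dyadic potentials. It dominates the
mean distance of a Sobolev map in `B(x, r) ∩ Ω` from its trace at `x`. -/
def boundaryPotential {X : Type*} [MetricSpace X] [MeasurableSpace X] (μ : Measure X) (Ω : Set X)
    (p lam : ℝ) (g : X → ℝ≥0∞) (r : ℝ) (x : X) : ℝ≥0∞ :=
  ∑' j : ℕ, ⨍⁻ z in Metric.ball x (r / 2 ^ j) ∩ Ω, potential μ Ω p lam g (4 * (r / 2 ^ j)) z ∂μ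

namespace IsWeaklyAdmissibleWith

theorem isFiniteMeasure {X : Type*} [MetricSpace X] [MeasurableSpace X] {μ : Measure X}
    {Ω : Set X} {H : Measure (frontier Ω)} {p θ : ℝ} {C K CH : ℝ≥0} {lam R : ℝ}
    (hA : IsWeaklyAdmissibleWith μ Ω H p θ C K CH lam R) :
    IsFiniteMeasure (μ.restrict Ω) :=
  ⟨by simpa using hA.doubling.measure_lt_top hA.isBounded⟩

variable {X Y : Type*} [MetricSpace X] [MeasurableSpace X] [BorelSpace X] [MetricSpace Y]
  {μ : Measure X} {Ω : Set X} {H : Measure (frontier Ω)} {p θ : ℝ} {C K CH : ℝ≥0} {lam R : ℝ}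
  {g : X → ℝ≥0∞} {u : X → Y}

theorem secondCountableTopology (hA : IsWeaklyAdmissibleWith μ Ω H p θ C K CH lam R) :
    SecondCountableTopology Ω :=
  hA.doubling.secondCountableTopology hA.isOpen.measurableSet hA.isBounded

theorem measurable_laverage (hA : IsWeaklyAdmissibleWith μ Ω H p θ C K CH lam R) (r : ℝ)
    {h : X → ℝ≥0∞} (hh : AEMeasurable h (μ.restrict Ω)) :
    Measurable fun x => ⨍⁻ z in Metric.ball x r ∩ Ω, h z ∂μ := by
  have := hA.isFiniteMeasure
  exact measurable_laverage_ball hA.isOpen.measurableSet hA.secondCountableTopology r hh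

theorem measurable_potential (hA : IsWeaklyAdmissibleWith μ Ω H p θ C K CH lam R)
    (hg : Measurable g) (r : ℝ) : Measurable (potential μ Ω p lam g r) := by
  have := hA.isFiniteMeasure
  exact MetricTrace.measurable_potential hA.isOpen.measurableSet hA.secondCountableTopology hg r

theorem measurable_boundaryPotential (hA : IsWeaklyAdmissibleWith μ Ω H p θ C K CH lam R)
    (hg : Measurable g) (r : ℝ) : Measurable (boundaryPotential μ Ω p lam g r) :=
  Measurable.tsum fun _ => hA.measurable_laverage _ (hA.measurable_potential hg _).aemeasurable

theorem lintegral_frontier_laverage_le [SFinite H]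
    (hA : IsWeaklyAdmissibleWith μ Ω H p θ C K CH lam R) {r : ℝ} (hr : 0 < r) (hrR : 2 * r ≤ R)
    {h : X → ℝ≥0∞} (hh : AEMeasurable h (μ.restrict Ω)) :
    ∫⁻ x : frontier Ω, ⨍⁻ z in Metric.ball (x : X) r ∩ Ω, h z ∂μ ∂H ≤
      (C : ℝ≥0∞) ^ 2 * (CH / ENNReal.ofReal ((2 * r) ^ θ)) * ∫⁻ z in Ω, h z ∂μ := by
  have := hA.isFiniteMeasure
  exact hA.doubling.lintegral_laverage_le hA.isOpen.measurableSet hA.secondCountableTopology H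
    measurable_subtype_coe hr (ae_of_all _ fun x => ⟨frontier_subset_closure x.2,
      hA.codim x (2 * r) (by positivity) hrR⟩) hh

/-- The `L^p` norm of the boundary potential on the boundary. The powers of the radii sum up to
`r ^ ((p - θ) / p)` because `θ < p`. -/
theorem exists_lintegral_boundaryPotential_le [SFinite H]
    (hA : IsWeaklyAdmissibleWith μ Ω H p θ C K CH lam R) :
    ∃ B : ℝ≥0∞, B ≠ ∞ ∧ ∀ r : ℝ, 0 < r → 2 * r ≤ R → ∀ g : X → ℝ≥0∞, Measurable g →
      ∫⁻ x : frontier Ω, boundaryPotential μ Ω p lam g r x ^ p ∂H ≤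
        B * ENNReal.ofReal (r ^ ((p - θ) / p)) ^ p * ∫⁻ z in Ω, g z ^ p ∂μ := by
  have hp := hA.one_lt
  have hp0 : 0 < p := by linarith
  have hβ : 0 < (p - θ) / p := div_pos (by linarith [hA.theta_lt]) hp0
  set β := (p - θ) / p with hβdef
  have hβp : β * p = p - θ := div_mul_cancel₀ _ hp0.ne'
  have hfin := hA.isFiniteMeasure
  set q : ℝ≥0∞ := ENNReal.ofReal ((2⁻¹ : ℝ) ^ β) with hq
  have hq1 : q < 1 := by
    rw [hq, ENNReal.ofReal_lt_one]
    exact Real.rpow_lt_one (by norm_num) (by norm_num) hβ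
  set W : ℝ≥0∞ := (1 - q)⁻¹ with hW
  have hWtop : W ≠ ∞ := ENNReal.inv_ne_top.2 (tsub_pos_of_lt hq1).ne'
  set A : ℝ≥0∞ := (C : ℝ≥0∞) ^ 2 * CH * (C : ℝ≥0∞) ^ 2 * ENNReal.ofReal (8 ^ p / 2 ^ θ) with hAdef
  refine ⟨A * W ^ p, by finiteness, fun r hr hrR g hg => ?_⟩
  have hsum : ∑' j : ℕ, ENNReal.ofReal ((r / 2 ^ j) ^ β) = ENNReal.ofReal (r ^ β) * W := by
    rw [hW, ← ENNReal.tsum_geometric, ← ENNReal.tsum_mul_left]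
    refine tsum_congr fun j => ?_
    rw [hq, ← ENNReal.ofReal_pow (by positivity), ← ENNReal.ofReal_mul (by positivity),
      div_eq_mul_inv, Real.mul_rpow hr.le (by positivity), ← inv_pow,
      ← Real.rpow_natCast, ← Real.rpow_mul (by norm_num), mul_comm (j : ℝ), Real.rpow_mul
      (by norm_num), Real.rpow_natCast]
  refine (lintegral_tsum_rpow_le (K := A * ∫⁻ z in Ω, g z ^ p ∂μ)
    (w := fun j => ENNReal.ofReal ((r / 2 ^ j) ^ β)) hp.le (fun j =>
    ((hA.measurable_laverage _ (hA.measurable_potential hg _).aemeasurable).comp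
      measurable_subtype_coe).aemeasurable) fun j => ?_).trans_eq ?_
  · have hrj : 0 < r / 2 ^ j := by positivity
    have hrjr : r / 2 ^ j ≤ r := div_le_self hr.le (one_le_pow₀ (by norm_num))
    set ρ := r / 2 ^ j with hρ
    have hS := hA.measurable_potential hg (4 * ρ)
    have hscale : (CH / ENNReal.ofReal ((2 * ρ) ^ θ)) * (ENNReal.ofReal (4 * ρ) * 2) ^ p =
        CH * ENNReal.ofReal (8 ^ p / 2 ^ θ) * ENNReal.ofReal (ρ ^ β) ^ p := by
      have h2 : ENNReal.ofReal (4 * ρ) * 2 = ENNReal.ofReal (8 * ρ) := by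
        rw [← ENNReal.ofReal_ofNat 2, ← ENNReal.ofReal_mul (by positivity)]
        congr 1; ring
      rw [h2, ENNReal.ofReal_rpow_of_pos (by positivity), div_eq_mul_inv,
        ← ENNReal.ofReal_inv_of_pos (by positivity), mul_assoc, mul_assoc,
        ENNReal.ofReal_rpow_of_pos (by positivity), ← ENNReal.ofReal_mul (by positivity),
        ← ENNReal.ofReal_mul (by positivity), ← Real.rpow_mul hrj.le, hβp,
        Real.mul_rpow (by norm_num) hrj.le, Real.mul_rpow (by norm_num) hrj.le,
        Real.rpow_sub hrj]
      congr 2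
      have : (2 : ℝ) ^ θ ≠ 0 := by positivity
      have : ρ ^ θ ≠ 0 := by positivity
      field_simp
    calc ∫⁻ x : frontier Ω, (⨍⁻ z in Metric.ball (x : X) ρ ∩ Ω,
          potential μ Ω p lam g (4 * ρ) z ∂μ) ^ p ∂H
        ≤ ∫⁻ x : frontier Ω, ⨍⁻ z in Metric.ball (x : X) ρ ∩ Ω,
          potential μ Ω p lam g (4 * ρ) z ^ p ∂μ ∂H := lintegral_mono fun x =>
            setLAverage_rpow_le (hA.doubling.pos (frontier_subset_closure x.2) hrj).ne'
              (hA.doubling.lt_top (frontier_subset_closure x.2) _).ne hp.le hS.aemeasurable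
      _ ≤ (C : ℝ≥0∞) ^ 2 * (CH / ENNReal.ofReal ((2 * ρ) ^ θ)) *
          ∫⁻ z in Ω, potential μ Ω p lam g (4 * ρ) z ^ p ∂μ :=
            hA.lintegral_frontier_laverage_le hrj (by linarith) (hS.pow_const p).aemeasurable
      _ ≤ (C : ℝ≥0∞) ^ 2 * (CH / ENNReal.ofReal ((2 * ρ) ^ θ)) *
          ((C : ℝ≥0∞) ^ 2 * (∫⁻ z in Ω, g z ^ p ∂μ) * (ENNReal.ofReal (4 * ρ) * 2) ^ p) := by
            gcongr
            exact hA.doubling.lintegral_potential_rpow_le hA.isOpen.measurableSet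
              hA.secondCountableTopology hp.le hA.one_le_lam hg (by positivity)
      _ = (C : ℝ≥0∞) ^ 2 * (C : ℝ≥0∞) ^ 2 * (∫⁻ z in Ω, g z ^ p ∂μ) *
          ((CH / ENNReal.ofReal ((2 * ρ) ^ θ)) * (ENNReal.ofReal (4 * ρ) * 2) ^ p) := by ring
      _ = _ := by rw [hscale, hAdef]; ring
  · rw [hsum, ENNReal.mul_rpow_of_nonneg _ _ hp0.le]
    ring

/-- On each ball centred at a point of `closure Ω`, a Sobolev map is on average close to one of its
values. -/
theorem exists_forall_exists_setLAverage_edist_le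
    (hA : IsWeaklyAdmissibleWith μ Ω H p θ C K CH lam R) (hu : MemLpMetric (μ.restrict Ω) p u)
    (hg : IsUpperGradient Ω u g) {x : X} (hx : x ∈ closure Ω) {r : ℝ} (hr : 0 < r) :
    ∃ a : Y, ⨍⁻ z in Metric.ball x r ∩ Ω, edist (u z) a ∂μ ≤
      (2 * (C : ℝ≥0∞) ^ 2 + 1) * K * 2 *
        ⨍⁻ z in Metric.ball x r ∩ Ω, potential μ Ω p lam g (4 * r) z ∂μ := by
  obtain ⟨s, hsΩ, hs, hsle⟩ := hA.doubling.exists_forall_edist_le_potential hA.poincare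
    hA.isOpen.measurableSet hA.isBounded hA.one_lt.le hu hg
  have hS := hA.measurable_potential hg.1 (4 * r)
  have h0 := hA.doubling.pos hx hr
  have ht := hA.doubling.lt_top hx r
  have hfin : IsFiniteMeasure (μ.restrict (Metric.ball x r ∩ Ω)) := ⟨by simpa using ht⟩
  have hae : ∀ᵐ z ∂μ.restrict (Metric.ball x r ∩ Ω), z ∈ s ∩ Metric.ball x r := by
    filter_upwards [ae_mono (Measure.restrict_mono inter_subset_right le_rfl) hs,
      ae_restrict_mem (Metric.isOpen_ball.measurableSet.inter hA.isOpen.measurableSet)]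
      with z h1 h2 using ⟨h1, h2.1⟩
  obtain ⟨w, hw, hwle⟩ := exists_notMem_null_le_laverage
    (by simpa using h0.ne') hS.aemeasurable (ae_iff.1 hae)
  simp only [mem_ofPred_eq, not_not] at hw
  refine ⟨u w, ?_⟩
  calc ⨍⁻ z in Metric.ball x r ∩ Ω, edist (u z) (u w) ∂μ
      ≤ ⨍⁻ z in Metric.ball x r ∩ Ω, (2 * (C : ℝ≥0∞) ^ 2 + 1) * K *
        (potential μ Ω p lam g (4 * r) z + potential μ Ω p lam g (4 * r) w) ∂μ := by
        refine setLAverage_mono_ae (hae.mono fun z hz => hsle z hz.1 w hw.1 r hr ?_)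
        have h1 : dist z x < r := hz.2
        have h2 : dist w x < r := hw.2
        linarith [dist_triangle_right z w x]
    _ = (2 * (C : ℝ≥0∞) ^ 2 + 1) * K *
        (⨍⁻ z in Metric.ball x r ∩ Ω, potential μ Ω p lam g (4 * r) z ∂μ +
          potential μ Ω p lam g (4 * r) w) := by
        rw [setLAverage_const_mul (hS.add_const _).aemeasurable,
          setLAverage_add_left hS.aemeasurable, setLAverage_const h0.ne' ht.ne]
    _ ≤ (2 * (C : ℝ≥0∞) ^ 2 + 1) * K *
        (⨍⁻ z in Metric.ball x r ∩ Ω, potential μ Ω p lam g (4 * r) z ∂μ +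
          ⨍⁻ z in Metric.ball x r ∩ Ω, potential μ Ω p lam g (4 * r) z ∂μ) := by gcongr
    _ = _ := by ring

theorem exists_isTraceAt [CompleteSpace Y] (hA : IsWeaklyAdmissibleWith μ Ω H p θ C K CH lam R)
    (hu : MemLpMetric (μ.restrict Ω) p u) (hg : IsUpperGradient Ω u g) {x : X}
    (hx : x ∈ closure Ω) {r : ℝ} (hr : 0 < r) (hfin : boundaryPotential μ Ω p lam g r x ≠ ∞) :
    ∃ y, IsTraceAt μ Ω u x y := by
  choose a ha using fun j : ℕ => hA.exists_forall_exists_setLAverage_edist_le hu hg hx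
    (show 0 < r / 2 ^ j by positivity)
  refine hA.doubling.exists_isTraceAt hu.1 hx hr ha ?_
  rw [ENNReal.tsum_mul_left]
  exact ENNReal.mul_ne_top (by finiteness) hfin

theorem setLAverage_edist_le_boundaryPotential
    (hA : IsWeaklyAdmissibleWith μ Ω H p θ C K CH lam R)
    (hu : MemLpMetric (μ.restrict Ω) p u) (hg : IsUpperGradient Ω u g) {x : X}
    (hx : x ∈ closure Ω) {r : ℝ} (hr : 0 < r) {y : Y} (hy : IsTraceAt μ Ω u x y) :
    ⨍⁻ z in Metric.ball x r ∩ Ω, edist (u z) y ∂μ ≤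
      ((C : ℝ≥0∞) ^ 2 + 2) * ((2 * (C : ℝ≥0∞) ^ 2 + 1) * K * 2) *
        boundaryPotential μ Ω p lam g r x := by
  choose a ha using fun j : ℕ => hA.exists_forall_exists_setLAverage_edist_le hu hg hx
    (show 0 < r / 2 ^ j by positivity)
  have h1 := hA.doubling.edist_le_tsum hu.1 hx hr ha hy
  have h2 := (ha 0).trans (mul_le_mul_right (ENNReal.le_tsum (f := fun j : ℕ =>
    ⨍⁻ z in Metric.ball x (r / 2 ^ j) ∩ Ω, potential μ Ω p lam g (4 * (r / 2 ^ j)) z ∂μ) 0) _)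
  rw [pow_zero, div_one] at h2
  rw [ENNReal.tsum_mul_left] at h1
  refine (setLAverage_edist_le (hA.doubling.pos hx hr).ne' (hA.doubling.lt_top hx r).ne u
    (a 0) y).trans ((add_le_add h2 h1).trans_eq ?_)
  rw [boundaryPotential]
  ring

/-- The distance of the traces of two maps is controlled by the distance of the maps on a small
ball and by the boundary potentials. -/
theorem edist_trace_le (hA : IsWeaklyAdmissibleWith μ Ω H p θ C K CH lam R) {v : X → Y}
    {g' : X → ℝ≥0∞} (hu : MemLpMetric (μ.restrict Ω) p u) (hv : MemLpMetric (μ.restrict Ω) p v)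
    (hg : IsUpperGradient Ω u g) (hg' : IsUpperGradient Ω v g') {x : X}
    (hx : x ∈ closure Ω) {r : ℝ} (hr : 0 < r) {y y' : Y} (hy : IsTraceAt μ Ω u x y)
    (hy' : IsTraceAt μ Ω v x y') :
    edist y y' ≤ ((C : ℝ≥0∞) ^ 2 + 2) * ((2 * (C : ℝ≥0∞) ^ 2 + 1) * K * 2) *
        boundaryPotential μ Ω p lam g r x +
      ((C : ℝ≥0∞) ^ 2 + 2) * ((2 * (C : ℝ≥0∞) ^ 2 + 1) * K * 2) *
        boundaryPotential μ Ω p lam g' r x +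
      ⨍⁻ z in Metric.ball x r ∩ Ω, edist (u z) (v z) ∂μ := by
  have h0 := (hA.doubling.pos hx hr).ne'
  have ht := (hA.doubling.lt_top hx r).ne
  have hmono : μ.restrict (Metric.ball x r ∩ Ω) ≤ μ.restrict Ω :=
    Measure.restrict_mono inter_subset_right le_rfl
  have hum := hu.1.mono_measure hmono
  have hvm := hv.1.mono_measure hmono
  refine le_trans ?_ (add_le_add (add_le_add
    (hA.setLAverage_edist_le_boundaryPotential hu hg hx hr hy)
    (hA.setLAverage_edist_le_boundaryPotential hv hg' hx hr hy')) le_rfl)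
  rw [← setLAverage_add_left (hum.edist aestronglyMeasurable_const),
    ← setLAverage_add_left (f := fun z => edist (u z) y + edist (v z) y')
      ((hum.edist aestronglyMeasurable_const).add (hvm.edist aestronglyMeasurable_const)),
    ← setLAverage_const h0 ht (edist y y')]
  refine setLAverage_mono_ae (ae_of_all _ fun z => ?_)
  calc edist y y' ≤ edist y (u z) + edist (u z) (v z) + edist (v z) y' := edist_triangle4 _ _ _ _
    _ = _ := by rw [edist_comm y]; ring

end IsWeaklyAdmissibleWith

namespace IsWeaklyAdmissibleWith

/-! ### The trace as an element of `L^p` of the boundary -/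

section Traces

variable {X Y : Type*} [MetricSpace X] [MeasurableSpace X] [MetricSpace Y]
  {μ : Measure X} {Ω : Set X} {H : Measure (frontier Ω)} {p θ : ℝ} {C K CH : ℝ≥0} {lam R : ℝ}
  {g : X → ℝ≥0∞} {u : X → Y}

/-- The trace takes values in the closure of the essential range. -/
theorem trace_mem_closure (hA : IsWeaklyAdmissibleWith μ Ω H p θ C K CH lam R)
    (hu : AEStronglyMeasurable u (μ.restrict Ω)) {t : Set Y} (ht : ∀ᵐ z ∂μ.restrict Ω, u z ∈ t)
    {x : X} (hx : x ∈ closure Ω) {y : Y} (hy : IsTraceAt μ Ω u x y) : y ∈ closure t := by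
  refine EMetric.mem_closure_iff.2 fun ε hε => ?_
  obtain ⟨r, hrε, hr⟩ := ((hy.eventually_lt_const hε).and eventually_mem_nhdsWithin).exists
  have hfin : IsFiniteMeasure (μ.restrict (Metric.ball x r ∩ Ω)) :=
    ⟨by simpa using hA.doubling.lt_top hx r⟩
  have hmono : μ.restrict (Metric.ball x r ∩ Ω) ≤ μ.restrict Ω :=
    Measure.restrict_mono inter_subset_right le_rfl
  obtain ⟨w, hw, hwle⟩ := exists_notMem_null_le_laverage
    (by simpa using (hA.doubling.pos hx hr).ne')
    ((hu.mono_measure hmono).edist (aestronglyMeasurable_const (b := y)))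
    (ae_iff.1 (ae_mono hmono ht))
  simp only [mem_ofPred_eq, not_not] at hw
  exact ⟨u w, hw, by rw [edist_comm]; exact hwle.trans_lt hrε⟩

variable [BorelSpace X]

/-- The distance from a fixed point to the trace is a limit of averages, hence measurable. -/
theorem aemeasurable_edist_trace (hA : IsWeaklyAdmissibleWith μ Ω H p θ C K CH lam R)
    (hu : AEStronglyMeasurable u (μ.restrict Ω)) {f : frontier Ω → Y} (hf : IsTrace μ Ω H u f)
    (y : Y) : AEMeasurable (fun x => edist (f x) y) H := by
  refine aemeasurable_of_tendsto_metrizable_ae atTop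
    (f := fun (j : ℕ) (x : frontier Ω) =>
      ⨍⁻ z in Metric.ball (x : X) (1 / 2 ^ j) ∩ Ω, edist (u z) y ∂μ)
    (fun j => ((hA.measurable_laverage _ (hu.edist aestronglyMeasurable_const)).comp
      measurable_subtype_coe).aemeasurable) ?_
  filter_upwards [hf] with x hx
  have hδ := hx.comp (tendsto_div_two_pow 1 one_pos)
  have hxc := frontier_subset_closure x.2
  have hup := hδ.add (tendsto_const_nhds (x := edist (f x) y))
  have hlo := ENNReal.Tendsto.sub (tendsto_const_nhds (x := edist (f x) y)) hδ
    (Or.inl (edist_ne_top _ _))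
  rw [zero_add] at hup
  rw [tsub_zero] at hlo
  refine tendsto_of_tendsto_of_tendsto_of_le_of_le hlo hup (fun j => ?_) (fun j => ?_)
  · have hj : (0 : ℝ) < 1 / 2 ^ j := by positivity
    exact tsub_le_iff_left.2 (edist_le_setLAverage_add (hA.doubling.pos hxc hj).ne'
      (hA.doubling.lt_top hxc _).ne
      (hu.mono_measure (Measure.restrict_mono inter_subset_right le_rfl)) _ _)
  · have hj : (0 : ℝ) < 1 / 2 ^ j := by positivity
    exact setLAverage_edist_le (hA.doubling.pos hxc hj).ne' (hA.doubling.lt_top hxc _).ne _ _ _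

theorem aestronglyMeasurable_trace (hA : IsWeaklyAdmissibleWith μ Ω H p θ C K CH lam R)
    (hu : AEStronglyMeasurable u (μ.restrict Ω)) {f : frontier Ω → Y} (hf : IsTrace μ Ω H u f) :
    AEStronglyMeasurable f H := by
  obtain ⟨t, ⟨c, hc, htc⟩, hut⟩ := hu.isSeparable_ae_range
  have hfc : ∀ᵐ x ∂H, f x ∈ closure c := hf.mono fun x hx =>
    closure_minimal htc isClosed_closure
      (hA.trace_mem_closure hu hut (frontier_subset_closure x.2) hx)
  rcases c.eq_empty_or_nonempty with rfl | hne
  · have hH : H = 0 := by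
      rw [← ae_eq_bot]
      exact eventually_false_iff_eq_bot.1 (hfc.mono fun x hx => by simp at hx)
    rw [hH]
    exact aestronglyMeasurable_zero_measure f
  obtain ⟨e, rfl⟩ := hc.exists_eq_range hne
  -- measurable versions of the distances to the points `e k`
  have hψ := fun k => hA.aemeasurable_edist_trace hu hf (e k)
  -- approximate `f x` by the first `e k` at distance less than `ε n`
  let ε : ℕ → ℝ≥0∞ := fun n => ((n : ℝ≥0∞) + 1)⁻¹
  let P : ℕ → frontier Ω → ℕ → Prop := fun n x k =>
    (∃ i, (hψ i).mk _ x < ε n) → (hψ k).mk _ x < ε n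
  have hP : ∀ n x, ∃ k, P n x k := fun n x => by
    by_cases h : ∃ i, (hψ i).mk _ x < ε n
    · exact ⟨h.choose, fun _ => h.choose_spec⟩
    · exact ⟨0, fun h' => absurd h' h⟩
  classical
  have hlt : ∀ n k, MeasurableSet {x | (hψ k).mk _ x < ε n} := fun n k =>
    measurableSet_lt (hψ k).measurable_mk measurable_const
  have hPm : ∀ n k, MeasurableSet {x | P n x k} := fun n k => by
    have h : {x | P n x k} = (⋃ i, {x | (hψ i).mk _ x < ε n})ᶜ ∪ {x | (hψ k).mk _ x < ε n} := by
      ext x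
      simp [P, imp_iff_not_or]
    rw [h]
    exact (MeasurableSet.iUnion fun i => hlt n i).compl.union (hlt n k)
  refine aestronglyMeasurable_of_tendsto_ae atTop (f := fun n x => e (Nat.find (hP n x)))
    (fun n => ?_) ?_
  · have hm : Measurable fun x => Nat.find (hP n x) := measurable_find (hP n) (hPm n)
    exact ((StronglyMeasurable.of_discrete (f := e)).comp_measurable hm).aestronglyMeasurable
  · filter_upwards [hfc, ae_all_iff.2 fun k => (hψ k).ae_eq_mk] with x hx hmk
    rw [tendsto_iff_edist_tendsto_0]
    have hε : Tendsto ε atTop (𝓝 0) := by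
      have := (tendsto_add_atTop_iff_nat 1).2 ENNReal.tendsto_inv_nat_nhds_zero
      simpa [ε] using this
    refine tendsto_of_tendsto_of_tendsto_of_le_of_le tendsto_const_nhds hε (fun _ => zero_le)
      fun n => ?_
    have hεn : 0 < ε n := ENNReal.inv_pos.2 (by finiteness)
    obtain ⟨_, ⟨i, rfl⟩, hi⟩ := EMetric.mem_closure_iff.1 hx (ε n) hεn
    have h := Nat.find_spec (hP n x) ⟨i, by rw [← hmk i]; exact hi⟩
    rw [← hmk, edist_comm] at h
    exact h.le

theorem exists_isTrace [CompleteSpace Y] [SFinite H]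
    (hA : IsWeaklyAdmissibleWith μ Ω H p θ C K CH lam R) (hu : MemLpMetric (μ.restrict Ω) p u)
    (hg : IsUpperGradient Ω u g) (hgp : ∫⁻ x in Ω, g x ^ p ∂μ < ∞) :
    ∃ f : frontier Ω → Y, IsTrace μ Ω H u f := by
  obtain ⟨B, hB, hBle⟩ := hA.exists_lintegral_boundaryPotential_le
  have hp0 : 0 < p := by linarith [hA.one_lt]
  have hr : 0 < R / 2 := half_pos hA.R_pos
  have hfin : ∀ᵐ x : frontier Ω ∂H, boundaryPotential μ Ω p lam g (R / 2) x ^ p < ∞ := by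
    refine ae_lt_top (((hA.measurable_boundaryPotential hg.1 _).comp
      measurable_subtype_coe).pow_const p) ((hBle _ hr (by linarith) g hg.1).trans_lt ?_).ne
    exact ENNReal.mul_lt_top (by finiteness) hgp
  obtain ⟨z₀, -⟩ := hu.2
  classical
  refine ⟨fun x => if h : ∃ y, IsTraceAt μ Ω u x y then h.choose else z₀, ?_⟩
  filter_upwards [hfin] with x hx
  have h : ∃ y, IsTraceAt μ Ω u x y := hA.exists_isTraceAt hu hg (frontier_subset_closure x.2) hr
    ((ENNReal.rpow_lt_top_iff_of_pos hp0).1 hx).ne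
  rw [dif_pos h]
  exact h.choose_spec

theorem memLpMetric_trace [SFinite H]
    (hA : IsWeaklyAdmissibleWith μ Ω H p θ C K CH lam R) (hu : MemLpMetric (μ.restrict Ω) p u)
    (hg : IsUpperGradient Ω u g) (hgp : ∫⁻ x in Ω, g x ^ p ∂μ < ∞) {f : frontier Ω → Y}
    (hf : IsTrace μ Ω H u f) : MemLpMetric H p f := by
  have hp := hA.one_lt
  have hp0 : 0 < p := by linarith
  have hr : 0 < R / 2 := half_pos hA.R_pos
  have hrR : 2 * (R / 2) ≤ R := by linarith
  obtain ⟨B, hB, hBle⟩ := hA.exists_lintegral_boundaryPotential_le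
  obtain ⟨z₀, hz₀⟩ := hu.2
  have hedist : AEMeasurable (fun z => edist (u z) z₀) (μ.restrict Ω) :=
    hu.1.edist aestronglyMeasurable_const
  refine ⟨hA.aestronglyMeasurable_trace hu.1 hf, z₀, ?_⟩
  set M : ℝ≥0∞ := ((C : ℝ≥0∞) ^ 2 + 2) * ((2 * (C : ℝ≥0∞) ^ 2 + 1) * K * 2)
  have hMtop : M ≠ ∞ := by finiteness
  set P : frontier Ω → ℝ≥0∞ := fun x => boundaryPotential μ Ω p lam g (R / 2) x
  have hPm : Measurable fun x => P x ^ p :=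
    ((hA.measurable_boundaryPotential hg.1 _).comp measurable_subtype_coe).pow_const p
  have hptw : ∀ᵐ x ∂H, edist (f x) z₀ ^ p ≤ 2 ^ (p - 1) * (M ^ p * P x ^ p +
      ⨍⁻ z in Metric.ball (x : X) (R / 2) ∩ Ω, edist (u z) z₀ ^ p ∂μ) := by
    filter_upwards [hf] with x hx
    have hxc := frontier_subset_closure x.2
    have h0 := (hA.doubling.pos hxc hr).ne'
    have ht := (hA.doubling.lt_top hxc (R / 2)).ne
    have hmono : μ.restrict (Metric.ball (x : X) (R / 2) ∩ Ω) ≤ μ.restrict Ω :=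
      Measure.restrict_mono inter_subset_right le_rfl
    refine (ENNReal.rpow_le_rpow ((edist_le_setLAverage_add h0 ht (hu.1.mono_measure hmono)
      (f x) z₀).trans (add_le_add (hA.setLAverage_edist_le_boundaryPotential hu hg hxc hr hx)
      le_rfl)) hp0.le).trans ((add_rpow_le hp.le _ _).trans ?_)
    rw [ENNReal.mul_rpow_of_nonneg _ _ hp0.le]
    gcongr
    exact setLAverage_rpow_le h0 ht hp.le (hedist.mono_measure hmono)
  refine (lintegral_mono_ae hptw).trans_lt ?_
  rw [lintegral_const_mul' _ _ (by finiteness), lintegral_add_left (hPm.const_mul _),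
    lintegral_const_mul _ hPm]
  refine ENNReal.mul_lt_top (by finiteness) (ENNReal.add_lt_top.2
    ⟨ENNReal.mul_lt_top (by finiteness) ((hBle _ hr hrR g hg.1).trans_lt
      (ENNReal.mul_lt_top (by finiteness) hgp)),
    (hA.lintegral_frontier_laverage_le hr hrR (hedist.pow_const p)).trans_lt
      (ENNReal.mul_lt_top (ENNReal.mul_lt_top (by finiteness)
        (ENNReal.div_lt_top (by finiteness) ?_)) hz₀)⟩)
  exact (ENNReal.ofReal_pos.2 (Real.rpow_pos_of_pos (by linarith) _)).ne'

/-! ### Continuity of the trace operator -/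

/-- The `L^p` distance of traces at scale `r`: a term that is small with `r`, uniformly on energy
bounded sets, and the `L^p` distance of the maps with a factor that depends on `r`. -/
theorem exists_lintegral_edist_trace_le [SFinite H]
    (hA : IsWeaklyAdmissibleWith μ Ω H p θ C K CH lam R) :
    ∃ B : ℝ≥0∞, B ≠ ∞ ∧ ∀ r : ℝ, 0 < r → 2 * r ≤ R → ∃ D : ℝ≥0∞, D ≠ ∞ ∧
      ∀ (u v : X → Y) (g g' : X → ℝ≥0∞) (f f' : frontier Ω → Y),
        MemLpMetric (μ.restrict Ω) p u → MemLpMetric (μ.restrict Ω) p v →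
        IsUpperGradient Ω u g → IsUpperGradient Ω v g' →
        IsTrace μ Ω H u f → IsTrace μ Ω H v f' →
        ∫⁻ x, edist (f x) (f' x) ^ p ∂H ≤
          B * (∫⁻ z in Ω, g z ^ p ∂μ + ∫⁻ z in Ω, g' z ^ p ∂μ) *
            ENNReal.ofReal (r ^ ((p - θ) / p)) ^ p +
          D * ∫⁻ z in Ω, edist (u z) (v z) ^ p ∂μ := by
  have hp := hA.one_lt
  have hp0 : 0 < p := by linarith
  obtain ⟨B, hB, hBle⟩ := hA.exists_lintegral_boundaryPotential_le
  set M : ℝ≥0∞ := ((C : ℝ≥0∞) ^ 2 + 2) * ((2 * (C : ℝ≥0∞) ^ 2 + 1) * K * 2)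
  have hMtop : M ≠ ∞ := by finiteness
  refine ⟨3 ^ (p - 1) * M ^ p * B, by finiteness, fun r hr hrR => ?_⟩
  refine ⟨3 ^ (p - 1) * ((C : ℝ≥0∞) ^ 2 * (CH / ENNReal.ofReal ((2 * r) ^ θ))), ?_, ?_⟩
  · exact ENNReal.mul_ne_top (by finiteness) (ENNReal.mul_ne_top (by finiteness)
      (ENNReal.div_lt_top (by finiteness)
        (ENNReal.ofReal_pos.2 (Real.rpow_pos_of_pos (by linarith) _)).ne').ne)
  intro u v g g' f f' hu hv hg hg' hf hf'
  have hedist : AEMeasurable (fun z => edist (u z) (v z)) (μ.restrict Ω) := hu.1.edist hv.1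
  have hPm : ∀ g : X → ℝ≥0∞, Measurable g → Measurable fun x : frontier Ω =>
      boundaryPotential μ Ω p lam g r x ^ p := fun g hg =>
    ((hA.measurable_boundaryPotential hg _).comp measurable_subtype_coe).pow_const p
  have hptw : ∀ᵐ x ∂H, edist (f x) (f' x) ^ p ≤ 3 ^ (p - 1) *
      (M ^ p * boundaryPotential μ Ω p lam g r x ^ p +
        M ^ p * boundaryPotential μ Ω p lam g' r x ^ p +
      ⨍⁻ z in Metric.ball (x : X) r ∩ Ω, edist (u z) (v z) ^ p ∂μ) := by
    filter_upwards [hf, hf'] with x hx hx'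
    have hxc := frontier_subset_closure x.2
    refine (ENNReal.rpow_le_rpow (hA.edist_trace_le hu hv hg hg' hxc hr hx hx') hp0.le).trans
      ((add_three_rpow_le hp.le _ _ _).trans ?_)
    rw [ENNReal.mul_rpow_of_nonneg M _ hp0.le, ENNReal.mul_rpow_of_nonneg M _ hp0.le]
    gcongr
    exact setLAverage_rpow_le (hA.doubling.pos hxc hr).ne' (hA.doubling.lt_top hxc r).ne hp.le
      (hedist.mono_measure (Measure.restrict_mono inter_subset_right le_rfl))
  refine (lintegral_mono_ae hptw).trans ?_
  rw [lintegral_const_mul' _ _ (by finiteness),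
    lintegral_add_left (f := fun x : frontier Ω =>
      M ^ p * boundaryPotential μ Ω p lam g r x ^ p +
        M ^ p * boundaryPotential μ Ω p lam g' r x ^ p)
      (((hPm g hg.1).const_mul _).add ((hPm g' hg'.1).const_mul _)),
    lintegral_add_left ((hPm g hg.1).const_mul _), lintegral_const_mul _ (hPm g hg.1),
    lintegral_const_mul _ (hPm g' hg'.1)]
  refine (mul_le_mul_right (add_le_add (add_le_add
    (mul_le_mul_right (hBle r hr hrR g hg.1) _) (mul_le_mul_right (hBle r hr hrR g' hg'.1) _))
    (hA.lintegral_frontier_laverage_le hr hrR (hedist.pow_const p))) _).trans_eq ?_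
  ring

theorem tendstoLpMetric_trace [SFinite H]
    (hA : IsWeaklyAdmissibleWith μ Ω H p θ C K CH lam R) {u : ℕ → X → Y} {v : X → Y}
    {g : ℕ → X → ℝ≥0∞} {g' : X → ℝ≥0∞} (hu : ∀ i, MemLpMetric (μ.restrict Ω) p (u i))
    (hv : MemLpMetric (μ.restrict Ω) p v) (hg : ∀ i, IsUpperGradient Ω (u i) (g i))
    (hg' : IsUpperGradient Ω v g') {G : ℝ≥0∞} (hG : G ≠ ∞)
    (hgG : ∀ i, ∫⁻ x in Ω, g i x ^ p ∂μ ≤ G) (hgp' : ∫⁻ x in Ω, g' x ^ p ∂μ ≠ ∞)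
    (huv : TendstoLpMetric (μ.restrict Ω) p u v) {Tu : ℕ → frontier Ω → Y} {Tv : frontier Ω → Y}
    (hTu : ∀ i, IsTrace μ Ω H (u i) (Tu i)) (hTv : IsTrace μ Ω H v Tv) :
    TendstoLpMetric H p Tu Tv := by
  have hp0 : 0 < p := by linarith [hA.one_lt]
  have hβ : 0 < (p - θ) / p := div_pos (by linarith [hA.theta_lt]) hp0
  obtain ⟨B, hB, hBle⟩ := hA.exists_lintegral_edist_trace_le (Y := Y)
  have hscale : Tendsto (fun r : ℝ => B * (G + ∫⁻ x in Ω, g' x ^ p ∂μ) *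
      ENNReal.ofReal (r ^ ((p - θ) / p)) ^ p) (𝓝[>] 0) (𝓝 0) := by
    have h1 : Tendsto (fun r : ℝ => r ^ ((p - θ) / p)) (𝓝[>] 0) (𝓝 0) := by
      have := (Real.continuousAt_rpow_const 0 ((p - θ) / p) (Or.inr hβ.le)).tendsto
      rw [Real.zero_rpow hβ.ne'] at this
      exact this.mono_left nhdsWithin_le_nhds
    have h2 := ((ENNReal.continuous_rpow_const (y := p)).tendsto _).comp
      (ENNReal.tendsto_ofReal h1)
    rw [ENNReal.ofReal_zero, ENNReal.zero_rpow_of_pos hp0] at h2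
    simpa using ENNReal.Tendsto.const_mul h2
      (a := B * (G + ∫⁻ x in Ω, g' x ^ p ∂μ)) (Or.inr (by finiteness))
  rw [TendstoLpMetric, ENNReal.tendsto_nhds_zero]
  intro ε hε
  -- choose the scale first, uniformly in `i`, and then `i` depending on the scale
  obtain ⟨r, hrε, hr⟩ := ((ENNReal.tendsto_nhds_zero.1 hscale (ε / 2)
    (ENNReal.half_pos hε.ne')).and (Ioo_mem_nhdsGT (half_pos hA.R_pos))).exists
  obtain ⟨D, hD, hDle⟩ := hBle r hr.1 (by linarith [hr.2])
  have hlim : Tendsto (fun i => D * ∫⁻ x in Ω, edist (u i x) (v x) ^ p ∂μ) atTop (𝓝 0) := by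
    simpa using ENNReal.Tendsto.const_mul huv (Or.inr hD)
  filter_upwards [ENNReal.tendsto_nhds_zero.1 hlim (ε / 2) (ENNReal.half_pos hε.ne')] with i hi
  refine (hDle _ _ _ _ _ _ (hu i) hv (hg i) hg' (hTu i) hTv).trans ?_
  rw [← ENNReal.add_halves ε]
  refine add_le_add (le_trans ?_ hrε) hi
  gcongr
  exact hgG i

end Traces

/-! ### Equality of traces -/

section Equality

variable {X Y : Type*} [MetricSpace X] [MeasurableSpace X] [MetricSpace Y]
  {μ : Measure X} {Ω : Set X} {H : Measure (frontier Ω)} {p θ : ℝ} {C K CH : ℝ≥0} {lam R : ℝ}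
  {g : X → ℝ≥0∞} {u : X → Y}

theorem isTrace_dist_of_ae_eq {v : X → Y} (hu : AEStronglyMeasurable u (μ.restrict Ω))
    {f f' : frontier Ω → Y} (hf : IsTrace μ Ω H u f) (hf' : IsTrace μ Ω H v f')
    (h : f =ᵐ[H] f') :
    IsTrace μ Ω H (fun x => dist (u x) (v x)) (fun _ => (0 : ℝ)) := by
  filter_upwards [hf, hf', h] with x hx hx' hxx
  have hlim := hx.add hx'
  rw [add_zero] at hlim
  refine tendsto_of_tendsto_of_tendsto_of_le_of_le tendsto_const_nhds hlim (fun _ => zero_le)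
    fun r => ?_
  rw [← setLAverage_add_left ((hu.mono_measure (Measure.restrict_mono inter_subset_right
    le_rfl)).edist aestronglyMeasurable_const), hxx]
  refine setLAverage_mono_ae (ae_of_all _ fun z => ?_)
  simp only
  rw [edist_dist, Real.dist_eq, sub_zero, abs_of_nonneg dist_nonneg, ← edist_dist]
  exact edist_triangle_right _ _ _

theorem ae_eq_of_isTrace_dist (hA : IsWeaklyAdmissibleWith μ Ω H p θ C K CH lam R) {v : X → Y}
    (hu : AEStronglyMeasurable u (μ.restrict Ω)) (hv : AEStronglyMeasurable v (μ.restrict Ω))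
    {f f' : frontier Ω → Y} (hf : IsTrace μ Ω H u f) (hf' : IsTrace μ Ω H v f')
    (h : IsTrace μ Ω H (fun x => dist (u x) (v x)) (fun _ => (0 : ℝ))) : f =ᵐ[H] f' := by
  filter_upwards [hf, hf', h] with x hx hx' hxx
  refine hx.unique hA.doubling hu (frontier_subset_closure x.2) ?_
  -- `v` is close to `f' x` and `u` is close to `v`, hence `f' x` is a trace of `u`, too
  have hlim := hxx.add hx'
  rw [add_zero] at hlim
  refine tendsto_of_tendsto_of_tendsto_of_le_of_le tendsto_const_nhds hlim (fun _ => zero_le)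
    fun r => ?_
  have hmono : μ.restrict (Metric.ball (x : X) r ∩ Ω) ≤ μ.restrict Ω :=
    Measure.restrict_mono inter_subset_right le_rfl
  rw [← setLAverage_add_left (((hu.mono_measure hmono).dist (hv.mono_measure hmono)).edist
    aestronglyMeasurable_const)]
  refine setLAverage_mono_ae (ae_of_all _ fun z => ?_)
  simp only
  rw [edist_dist (dist (u z) (v z)), Real.dist_eq, sub_zero, abs_of_nonneg dist_nonneg,
    ← edist_dist]
  exact edist_triangle _ _ _

theorem memSobolev_dist (hA : IsWeaklyAdmissibleWith μ Ω H p θ C K CH lam R) {v : X → Y}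
    {g' : X → ℝ≥0∞} (hu : MemLpMetric (μ.restrict Ω) p u) (hv : MemLpMetric (μ.restrict Ω) p v)
    (hg : IsUpperGradient Ω u g) (hg' : IsUpperGradient Ω v g')
    (hgp : ∫⁻ x in Ω, g x ^ p ∂μ < ∞) (hgp' : ∫⁻ x in Ω, g' x ^ p ∂μ < ∞) :
    MemSobolev μ Ω p fun x => dist (u x) (v x) := by
  have hp := hA.one_lt
  have hp0 : 0 < p := by linarith
  obtain ⟨hum, a, ha⟩ := hu
  obtain ⟨hvm, b, hb⟩ := hv
  have hua : AEMeasurable (fun x => edist (u x) a ^ p) (μ.restrict Ω) :=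
    (hum.edist aestronglyMeasurable_const).pow_const p
  have hvb : AEMeasurable (fun x => edist (v x) b ^ p) (μ.restrict Ω) :=
    (hvm.edist aestronglyMeasurable_const).pow_const p
  refine ⟨⟨hum.dist hvm, 0, ?_⟩, _, (hg.dist hg').isWeakUpperGradient hp0, ?_⟩
  · calc ∫⁻ x in Ω, edist (dist (u x) (v x)) 0 ^ p ∂μ
        ≤ ∫⁻ x in Ω, 3 ^ (p - 1) * (edist (u x) a ^ p + edist (v x) b ^ p + edist a b ^ p) ∂μ := by
          refine lintegral_mono fun x => le_trans (ENNReal.rpow_le_rpow ?_ hp0.le)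
            (add_three_rpow_le hp.le _ _ _)
          rw [edist_dist, Real.dist_eq, sub_zero, abs_of_nonneg dist_nonneg, ← edist_dist]
          refine (edist_triangle4 (u x) a b (v x)).trans_eq ?_
          rw [edist_comm b]
          ring
      _ = 3 ^ (p - 1) * (∫⁻ x in Ω, edist (u x) a ^ p ∂μ + ∫⁻ x in Ω, edist (v x) b ^ p ∂μ +
            edist a b ^ p * μ Ω) := by
          rw [lintegral_const_mul' _ _ (by finiteness),
            lintegral_add_left' (f := fun x => edist (u x) a ^ p + edist (v x) b ^ p)
              (hua.add hvb), lintegral_add_left' hua, setLIntegral_const]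
      _ < ∞ := ENNReal.mul_lt_top (by finiteness) (ENNReal.add_lt_top.2
          ⟨ENNReal.add_lt_top.2 ⟨ha, hb⟩, ENNReal.mul_lt_top (by finiteness)
            (hA.doubling.measure_lt_top hA.isBounded)⟩)
  · refine (lintegral_mono fun x => add_rpow_le hp.le _ _).trans_lt ?_
    rw [lintegral_const_mul' _ _ (by finiteness), lintegral_add_left (hg.1.pow_const p)]
    exact ENNReal.mul_lt_top (by finiteness) (ENNReal.add_lt_top.2 ⟨hgp, hgp'⟩)

end Equality

end IsWeaklyAdmissibleWith

theorem MemSobolev.exists_isUpperGradient {X Z : Type*} [MetricSpace X] [MeasurableSpace X]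
    [MetricSpace Z] {μ : Measure X} {Ω : Set X} {p : ℝ} (hp : 1 ≤ p) {u : X → Z}
    (hu : MemSobolev μ Ω p u) :
    ∃ g : X → ℝ≥0∞, IsUpperGradient Ω u g ∧ ∫⁻ x in Ω, g x ^ p ∂μ < ∞ := by
  obtain ⟨-, g, hg, hgp⟩ := hu
  obtain ⟨G, hG, hle⟩ := hg.exists_isUpperGradient hp
  exact ⟨G, hG, hle.trans_lt (ENNReal.mul_lt_top (by finiteness)
    (ENNReal.add_lt_top.2 ⟨hgp, by finiteness⟩))⟩

theorem exists_isUpperGradient_of_energy_lt {X Z : Type*} [MetricSpace X] [MeasurableSpace X]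
    [MetricSpace Z] {μ : Measure X} {Ω : Set X} {p : ℝ} (hp : 1 ≤ p) {u : X → Z} {M : ℝ≥0∞}
    (hu : energy μ Ω p u < M) :
    ∃ g : X → ℝ≥0∞, IsUpperGradient Ω u g ∧
      ∫⁻ x in Ω, g x ^ p ∂μ ≤ 2 ^ (p - 1) * (M + 2 ^ p) := by
  simp only [energy, iInf_lt_iff] at hu
  obtain ⟨g, hg, hgM⟩ := hu
  obtain ⟨G, hG, hle⟩ := hg.exists_isUpperGradient hp
  exact ⟨G, hG, hle.trans (by gcongr)⟩

end MetricTrace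

end

theorem theorem3p4 {X Y : Type*} [MetricSpace X] [CompleteSpace X] [MeasurableSpace X]
    [BorelSpace X] [MetricSpace Y] [CompleteSpace Y]
    (μ : Measure X) (Ω : Set X) (hΩ_open : IsOpen Ω) (hΩ_conn : IsConnected Ω)
    (hΩ_bdd : Bornology.IsBounded Ω)
    (H : Measure (frontier Ω)) [SigmaFinite H] (p θ : ℝ)
    (hΩ : MetricTrace.IsWeaklyAdmissible μ Ω H p θ) :
    -- every Sobolev map has a trace, and the trace is in `L^p(∂Ω, Y)`
    (∀ u : X → Y, MetricTrace.MemSobolev μ Ω p u →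
      ∃ f : frontier Ω → Y, MetricTrace.IsTrace μ Ω H u f ∧ MetricTrace.MemLpMetric H p f) ∧
    -- convergence of the traces
    (∀ (u : ℕ → X → Y) (v : X → Y),
      (∀ i, MetricTrace.MemSobolev μ Ω p (u i)) → MetricTrace.MemSobolev μ Ω p v →
      (⨆ i, MetricTrace.energy μ Ω p (u i)) < ∞ →
      MetricTrace.TendstoLpMetric (μ.restrict Ω) p u v →
      ∀ (Tu : ℕ → frontier Ω → Y) (Tv : frontier Ω → Y),
        (∀ i, MetricTrace.IsTrace μ Ω H (u i) (Tu i)) → MetricTrace.IsTrace μ Ω H v Tv →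
        MetricTrace.TendstoLpMetric H p Tu Tv) ∧
    -- characterization of equality of traces
    (∀ u v : X → Y, MetricTrace.MemSobolev μ Ω p u → MetricTrace.MemSobolev μ Ω p v →
      ∀ Tu Tv : frontier Ω → Y,
        MetricTrace.IsTrace μ Ω H u Tu → MetricTrace.IsTrace μ Ω H v Tv →
        (Tu =ᵐ[H] Tv ↔
          MetricTrace.MemSobolev μ Ω p (fun x => dist (u x) (v x)) ∧
          MetricTrace.IsTrace μ Ω H (fun x => dist (u x) (v x)) (fun _ => (0 : ℝ)))) := by
  obtain ⟨C, K, CH, lam, R, hA⟩ := hΩ.exists_with hΩ_open hΩ_bdd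
  have hp := hA.one_lt.le
  refine ⟨fun u hu => ?_, fun u v hu hv hE huv Tu Tv hTu hTv => ?_,
    fun u v hu hv Tu Tv hTu hTv => ⟨fun h => ⟨?_, ?_⟩, fun h => ?_⟩⟩
  · obtain ⟨g, hg, hgp⟩ := hu.exists_isUpperGradient hp
    obtain ⟨f, hf⟩ := hA.exists_isTrace hu.1 hg hgp
    exact ⟨f, hf, hA.memLpMetric_trace hu.1 hg hgp hf⟩
  · obtain ⟨g', hg', hgp'⟩ := hv.exists_isUpperGradient hp
    set M : ℝ≥0∞ := (⨆ i, MetricTrace.energy μ Ω p (u i)) + 1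
    have hMtop : M ≠ ∞ := ENNReal.add_ne_top.2 ⟨hE.ne, by finiteness⟩
    have hlt : ∀ i, MetricTrace.energy μ Ω p (u i) < M := fun i =>
      (le_iSup (fun i => MetricTrace.energy μ Ω p (u i)) i).trans_lt
        (ENNReal.lt_add_right hE.ne one_ne_zero)
    choose g hg hgM using fun i => MetricTrace.exists_isUpperGradient_of_energy_lt hp (hlt i)
    exact hA.tendstoLpMetric_trace (fun i => (hu i).1) hv.1 hg hg' (by finiteness) hgM hgp'.ne
      huv hTu hTv
  · obtain ⟨g, hg, hgp⟩ := hu.exists_isUpperGradient hp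
    obtain ⟨g', hg', hgp'⟩ := hv.exists_isUpperGradient hp
    exact hA.memSobolev_dist hu.1 hv.1 hg hg' hgp hgp'
  · exact MetricTrace.IsWeaklyAdmissibleWith.isTrace_dist_of_ae_eq hu.1.1 hTu hTv h
  · exact hA.ae_eq_of_isTrace_dist hu.1.1 hv.1.1 hTu hTv h.2
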